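/- Let $M$ be a smooth $2$-dimensional manifold with slit tangent bundle $\mathcal{T}M=TM\setminus\{0\}$, and let $F:TM\to\mathbb{R}$ be a smooth Finsler structure: $F$ vanishes on the zero section, is positive and $C^\infty$ on $\mathcal{T}M$, is positively homogeneous of degree $1$ in $y$, and $g_{ij}=\frac12\,\partial^2F^2/\partial y^i\partial y^j$ has maximal rank on $\mathcal{T}M$. Let $$S=y^i\frac{\partial}{\partial x^i}-2G^i\frac{\partial}{\partial y^i},\qquad G^i=\tfrac14 g^{ij}\Big(y^k\frac{\partial^2F^2}{\partial x^k\partial y^j}-\frac{\partial F^2}{\partial x^j}\Big)$$ be its geodesic spray, put $G^i_j=\partial G^i/\partial y^j$, and let $\rho=R^i_i$ be the Ricci scalar, where $R^i_j=2\,\partial G^i/\partial x^j-S(G^i_j)-G^i_kG^k_j$; thus $\rho=KF^2$ with $K$ the flag curvature. Let $V=m^i\,\partial/\partial y^i$ be the vertical field, locally defined and smooth on $\mathcal{T}M$, unique up to sign, with $V(F)=0$ and $g(m,m)=F^2$, and let $H=m^i\big(\partial/\partial x^i-G^j_i\,\partial/\partial y^j\big)$, so that $V=JH$ for the almost tangent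 structure $J=\frac{\partial}{\partial y^i}\otimes dx^i$; then $\mathcal{D}=\operatorname{span}\{S,H,V\}$ is the Berwald distribution. Let $\mathcal{I}=C_{ijk}m^im^jm^k/F^2$, with $C_{ijk}=\frac12\,\partial g_{ij}/\partial y^k$, be the Cartan (main) scalar (the coefficient of $H$ in $[H,V]=S+\mathcal{I}H+\mathcal{J}V$), and let $\mathcal{J}=S(\mathcal{I})$ be the Landsberg scalar. Replacing $(H,V)$ by $(-H,-V)$ changes the signs of $\mathcal{I}$ and $\mathcal{J}$, so the conditions below do not depend on the choice of sign. Suppose that $V(\rho)=-\mathcal{I}$ on the indicatrix bundle $IM=\{F=1\}$ (equivalently, $V(K)=-\mathcal{I}/F^2$ on $IM$). If either $S(\rho)=0$ on $IM$ or $S(\mathcal{J})=0$ on $IM$, then $(M,F)$ is Riemannian, i.e. there is a smooth Riemannian metric $h$ on $M$ with $F(v)^2=h(v,v)$ for all $v\in TM$. -/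

import Mathlib

open scoped Manifold ContDiff

noncomputable section

namespace FinslerSurface

/-- The model plane `ℝ²`. -/
abbrev Plane : Type := EuclideanSpace ℝ (Fin 2)

/-! ### Local expressions

A point `p = (x, y)` of `Plane × Plane` stands for the tangent vector with induced coordinates
`(x, y) = (x⁰, x¹, y⁰, y¹)`.  Below, `L` is the local expression `L(x, y)` of a Finsler function in
a chart of the tangent bundle.  A tangent vector at `p` is again a pair `(a, b)`, standing for
`aⁱ ∂/∂xⁱ + bⁱ ∂/∂yⁱ`. -/

/-- The partial derivative `∂f/∂xⁱ`. -/
def dx (i : Fin 2) (f : Plane × Plane → ℝ) (p : Plane × Plane) : ℝ :=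
  fderiv ℝ f p (EuclideanSpace.single i (1 : ℝ), 0)

/-- The partial derivative `∂f/∂yⁱ`. -/
def dy (i : Fin 2) (f : Plane × Plane → ℝ) (p : Plane × Plane) : ℝ :=
  fderiv ℝ f p (0, EuclideanSpace.single i (1 : ℝ))

/-- The derivative `X(f)` of a function along a vector field. -/
def along (X : Plane × Plane → Plane × Plane) (f : Plane × Plane → ℝ) (p : Plane × Plane) : ℝ :=
  fderiv ℝ f p (X p)

/-- The almost tangent structure `J = ∂/∂yⁱ ⊗ dxⁱ`. -/
def almostTangent (w : Plane × Plane) : Plane × Plane := (0, w.1)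

/-- The metric tensor `g_{ij} = ½ ∂²L²/∂yⁱ∂yʲ`. -/
def metricTensor (L : Plane × Plane → ℝ) (p : Plane × Plane) : Matrix (Fin 2) (Fin 2) ℝ :=
  Matrix.of fun i j => (1 / 2 : ℝ) * dy i (dy j (fun q => L q ^ 2)) p

/-- The Cartan tensor `C_{ijk} = ½ ∂g_{ij}/∂yᵏ`. -/
def cartanTensor (L : Plane × Plane → ℝ) (i j k : Fin 2) (p : Plane × Plane) : ℝ :=
  (1 / 2 : ℝ) * dy k (fun q => metricTensor L q i j) p

/-- The coefficients of the geodesic spray,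
`Gⁱ = ¼ gⁱʲ (yᵏ ∂²L²/∂xᵏ∂yʲ - ∂L²/∂xʲ)`. -/
def sprayCoeff (L : Plane × Plane → ℝ) (i : Fin 2) (p : Plane × Plane) : ℝ :=
  (1 / 4 : ℝ) * ∑ j, (metricTensor L p)⁻¹ i j *
    ((∑ k, p.2 k * dx k (dy j (fun q => L q ^ 2)) p) - dx j (fun q => L q ^ 2) p)

/-- The geodesic spray `S = yⁱ ∂/∂xⁱ - 2 Gⁱ ∂/∂yⁱ`. -/
def spray (L : Plane × Plane → ℝ) (p : Plane × Plane) : Plane × Plane :=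
  (p.2, !₂[-2 * sprayCoeff L 0 p, -2 * sprayCoeff L 1 p])

/-- The coefficients `Gⁱ_j = ∂Gⁱ/∂yʲ` of the canonical nonlinear connection of the spray. -/
def connCoeff (L : Plane × Plane → ℝ) (i j : Fin 2) (p : Plane × Plane) : ℝ :=
  dy j (sprayCoeff L i) p

/-- The components of the Jacobi endomorphism,
`Rⁱ_j = 2 ∂Gⁱ/∂xʲ - S(Gⁱ_j) - Gⁱ_k Gᵏ_j`. -/
def jacobiEndo (L : Plane × Plane → ℝ) (i j : Fin 2) (p : Plane × Plane) : ℝ :=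
  2 * dx j (sprayCoeff L i) p - along (spray L) (connCoeff L i j) p
    - ∑ k, connCoeff L i k p * connCoeff L k j p

/-- The Ricci scalar `ρ = Tr Φ = Rⁱ_i`. -/
def ricciScalar (L : Plane × Plane → ℝ) (p : Plane × Plane) : ℝ :=
  ∑ i, jacobiEndo L i i p

/-- The vector `m = (L / √det g) (-∂L/∂y¹, ∂L/∂y⁰)`.  It is the vector with `mⁱ ∂L/∂yⁱ = 0` and
`g(m, m) = L²` for which `(y, m)` is positively oriented in the chart; the only other vector with
the first two properties is `-m`. -/
def berwaldVec (L : Plane × Plane → ℝ) (p : Plane × Plane) : Plane :=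
  (L p / √(metricTensor L p).det) • !₂[-dy 1 L p, dy 0 L p]

/-- The horizontal vector field `H = mⁱ (∂/∂xⁱ - Gʲ_i ∂/∂yʲ)` of the Berwald frame, which
satisfies `d_J L (H) = 0` and hence `β(H) = 0` for `β = K L d_J L`.  It is determined by the
Finsler function up to its sign. -/
def berwaldH (L : Plane × Plane → ℝ) (p : Plane × Plane) : Plane × Plane :=
  (berwaldVec L p,
    !₂[-∑ i, connCoeff L 0 i p * berwaldVec L p i, -∑ i, connCoeff L 1 i p * berwaldVec L p i])

/-- The vertical vector field `V = J H` of the Berwald frame. -/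
def berwaldV (L : Plane × Plane → ℝ) (p : Plane × Plane) : Plane × Plane :=
  almostTangent (berwaldH L p)

/-- The Cartan (main) scalar `𝓘 = C(m, m, m) / L²`, that is, `L C(n, n, n)` for the unit vector
`n = m / L`.  It is the coefficient of `H` in `[H, V] = S + 𝓘 H + 𝓙 V`, and it changes sign
when `H` does. -/
def mainScalar (L : Plane × Plane → ℝ) (p : Plane × Plane) : ℝ :=
  (∑ i, ∑ j, ∑ k,
    cartanTensor L i j k p * berwaldVec L p i * berwaldVec L p j * berwaldVec L p k) / L p ^ 2

/-- The Landsberg scalar `𝓙 = S(𝓘)`. -/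
def landsbergScalar (L : Plane × Plane → ℝ) (p : Plane × Plane) : ℝ :=
  along (spray L) (mainScalar L) p

/-! ### Finsler surfaces -/

section Manifold

variable {M : Type*} [TopologicalSpace M] [ChartedSpace Plane M] [IsManifold (𝓡 2) ∞ M]

/-- The induced coordinates `(x, y)` on `TM` given by the preferred chart of `M` at `x₀`. -/
def tangentChart (x₀ : M) : PartialEquiv (TangentBundle (𝓡 2) M) (Plane × Plane) :=
  extChartAt (𝓡 2).tangent (⟨x₀, 0⟩ : TangentBundle (𝓡 2) M)

/-- The local expression of a function on `TM` in the induced coordinates. -/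
def localExpr (F : TangentBundle (𝓡 2) M → ℝ) (x₀ : M) (p : Plane × Plane) : ℝ :=
  F ((tangentChart x₀).symm p)

/-- The indicatrix bundle `IM = {F = 1}` in the induced coordinates. -/
def indicatrix (F : TangentBundle (𝓡 2) M → ℝ) (x₀ : M) : Set (Plane × Plane) :=
  {p | p ∈ (tangentChart x₀).target ∧ localExpr F x₀ p = 1}

/-- `F` is a smooth Finsler structure on the surface `M`. -/
structure IsFinsler (F : TangentBundle (𝓡 2) M → ℝ) : Prop where
  smooth : ContMDiffOn (𝓡 2).tangent 𝓘(ℝ, ℝ) ∞ F {u | u.2 ≠ 0}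
  zero : ∀ x : M, F ⟨x, 0⟩ = 0
  pos : ∀ (x : M) (v : TangentSpace (𝓡 2) x), v ≠ 0 → 0 < F ⟨x, v⟩
  homog : ∀ (x : M) (v : TangentSpace (𝓡 2) x) (t : ℝ), 0 < t → F ⟨x, t • v⟩ = t * F ⟨x, v⟩
  nondegenerate : ∀ (x₀ : M) (p : Plane × Plane), p ∈ (tangentChart x₀).target → p.2 ≠ 0 →
    (metricTensor (localExpr F x₀) p).det ≠ 0

/-- `F` is Riemannian: `F² (v) = g(v, v)` for a smooth Riemannian metric `g` on `M`. -/
def IsRiemannian (F : TangentBundle (𝓡 2) M → ℝ) : Prop :=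
  ∃ g : Bundle.ContMDiffRiemannianMetric (𝓡 2) ∞ Plane (fun x : M => TangentSpace (𝓡 2) x),
    ∀ (x : M) (v : TangentSpace (𝓡 2) x), F ⟨x, v⟩ ^ 2 = g.inner x v v

end Manifold

end FinslerSurface

end

noncomputable section

/-! ### Finsler calculus over a commutative algebra with derivations -/

namespace FinslerSurface

/-! The Berwald frame satisfies `[V, S] = H`, `[S, H] = ρ V` and `[H, V] = a S + 𝓘 H + b V` (`V_S`,
`S_H`, `H_V`). The Jacobi identity forces `b = S(𝓘)` and yields `S(S(𝓘)) + 𝓘 ρ + V(ρ) = 0`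
(`bianchi`). The three fields annihilate `L`, hence are tangent to `{L = 1}`, and relations valid
only there may be differentiated along them. This is expressed by congruences modulo the ideal of
functions vanishing on `{L = 1}`.

Let `V(ρ) ≡ -𝓘`. If `S(𝓙) ≡ 0`, Bianchi gives `𝓘 (ρ - 1) ≡ 0`; applying `V` and multiplying by `𝓘`
leaves `𝓘³ ≡ 0`, and the ideal is radical. If `S(ρ) ≡ 0`, the first bracket applied to `ρ` gives
`H(ρ) ≡ S(𝓘)`, the second gives `S(S(𝓘)) ≡ ρ V(ρ) ≡ -ρ 𝓘`, and Bianchi leaves `V(ρ) ≡ 0`, so `𝓘 ≡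
0`.

In dimension two the Cartan tensor is a multiple of `𝓘` (`C_eq`). It is homogeneous of degree `-1`,
so it vanishes on the whole slit bundle. The metric tensor is then constant on each fibre, which is
connected, and `L²` is quadratic there (`fibreForm_self`). Polarization glues the chart expressions
into a smooth metric.

The frame contains `√det g`, so nondegeneracy must first be improved to `det g > 0`: this holds at a
minimum of `L` on a Euclidean circle in the fibre, and connectedness spreads it (`exists_det_pos`,
`det_pos`). -/

/-- A commutative algebra of functions of `(x⁰, x¹, y⁰, y¹)` with its partial derivatives, and a
Finsler function `L` in it. -/
structure Calculus (A : Type*) [CommRing A] [Algebra ℝ A] where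
  X : Fin 2 → Derivation ℝ A A
  Y : Fin 2 → Derivation ℝ A A
  x : Fin 2 → A
  y : Fin 2 → A
  XX : ∀ i j f, X i (X j f) = X j (X i f)
  YX : ∀ i j f, Y i (X j f) = X j (Y i f)
  YY : ∀ i j f, Y i (Y j f) = Y j (Y i f)
  Xx : ∀ i j, X i (x j) = if i = j then 1 else 0
  Xy : ∀ i j, X i (y j) = 0
  Yx : ∀ i j, Y i (x j) = 0
  Yy : ∀ i j, Y i (y j) = if i = j then 1 else 0
  L : A
  Linv : A
  L_mul_Linv : L * Linv = 1
  euler : y 0 * Y 0 L + y 1 * Y 1 L = L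
  s : A
  sinv : A
  s_mul_sinv : s * sinv = 1
  s_sq : s * s =
    (algebraMap ℝ A (1 / 2) * Y 0 (Y 0 (L ^ 2))) * (algebraMap ℝ A (1 / 2) * Y 1 (Y 1 (L ^ 2)))
    - (algebraMap ℝ A (1 / 2) * Y 0 (Y 1 (L ^ 2))) * (algebraMap ℝ A (1 / 2) * Y 1 (Y 0 (L ^ 2)))

namespace Calculus

variable {A : Type*} [CommRing A] [Algebra ℝ A] (c : Calculus A)

/-- The metric tensor. -/
def g (i j : Fin 2) : A := algebraMap ℝ A (1 / 2) * c.Y i (c.Y j (c.L ^ 2))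

/-- The inverse of the metric tensor. -/
def ginv (i j : Fin 2) : A :=
  if i = j then c.sinv ^ 2 * c.g (1 - i) (1 - j) else -(c.sinv ^ 2 * c.g i j)

/-- The covector `yᵏ ∂²L²/∂xᵏ∂yʲ - ∂L²/∂xʲ`. -/
def b (j : Fin 2) : A :=
  c.y 0 * c.X 0 (c.Y j (c.L ^ 2)) + c.y 1 * c.X 1 (c.Y j (c.L ^ 2)) - c.X j (c.L ^ 2)

/-- The spray coefficients. -/
def G (i : Fin 2) : A := algebraMap ℝ A (1 / 4) * (c.ginv i 0 * c.b 0 + c.ginv i 1 * c.b 1)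

/-- The geodesic spray. -/
def S : Derivation ℝ A A :=
  c.y 0 • c.X 0 + c.y 1 • c.X 1 + (-2 * c.G 0) • c.Y 0 + (-2 * c.G 1) • c.Y 1

/-- The coefficients of the canonical nonlinear connection. -/
def N (i j : Fin 2) : A := c.Y j (c.G i)

/-- The Jacobi endomorphism. -/
def R (i j : Fin 2) : A :=
  2 * c.X j (c.G i) - c.S (c.N i j) - (c.N i 0 * c.N 0 j + c.N i 1 * c.N 1 j)

/-- The Ricci scalar. -/
def ricci : A := c.R 0 0 + c.R 1 1

/-- The vector of the Berwald frame. -/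
def m (i : Fin 2) : A := c.L * c.sinv * (if i = 0 then -c.Y 1 c.L else c.Y 0 c.L)

/-- The horizontal field of the Berwald frame. -/
def H : Derivation ℝ A A :=
  c.m 0 • c.X 0 + c.m 1 • c.X 1 + (-(c.N 0 0 * c.m 0 + c.N 0 1 * c.m 1)) • c.Y 0
    + (-(c.N 1 0 * c.m 0 + c.N 1 1 * c.m 1)) • c.Y 1

/-- The vertical field of the Berwald frame. -/
def V : Derivation ℝ A A := c.m 0 • c.Y 0 + c.m 1 • c.Y 1

/-- The Liouville field. -/
def liouville : Derivation ℝ A A := c.y 0 • c.Y 0 + c.y 1 • c.Y 1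

/-- The Cartan tensor. -/
def C (i j k : Fin 2) : A := algebraMap ℝ A (1 / 2) * c.Y k (c.g i j)

/-- The main scalar. -/
def main : A := (∑ i, ∑ j, ∑ k, c.C i j k * c.m i * c.m j * c.m k) * c.Linv ^ 2

/-! ### Evaluation of the fields -/

theorem S_apply (f : A) : c.S f = c.y 0 * c.X 0 f + c.y 1 * c.X 1 f - 2 * c.G 0 * c.Y 0 f
    - 2 * c.G 1 * c.Y 1 f := by
  simp [S]; ring

theorem H_apply (f : A) : c.H f = c.m 0 * c.X 0 f + c.m 1 * c.X 1 f
    - (c.N 0 0 * c.m 0 + c.N 0 1 * c.m 1) * c.Y 0 f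
    - (c.N 1 0 * c.m 0 + c.N 1 1 * c.m 1) * c.Y 1 f := by
  simp [H]; ring

theorem V_apply (f : A) : c.V f = c.m 0 * c.Y 0 f + c.m 1 * c.Y 1 f := by
  simp [V]

theorem liouville_apply (f : A) : c.liouville f = c.y 0 * c.Y 0 f + c.y 1 * c.Y 1 f := by
  simp [liouville]

theorem two_mul_half : (2 : A) * algebraMap ℝ A (1 / 2) = 1 := by
  rw [← map_ofNat (algebraMap ℝ A) 2, ← map_mul]; norm_num

theorem four_mul_quarter : (4 : A) * algebraMap ℝ A (1 / 4) = 1 := by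
  rw [← map_ofNat (algebraMap ℝ A) 4, ← map_mul]; norm_num

theorem two_cancel {a b : A} (h : 2 * a = 2 * b) : a = b := by
  linear_combination algebraMap ℝ A (1 / 2) * h - (a - b) * two_mul_half (A := A)

theorem L_cancel {a b : A} (h : c.L * a = c.L * b) : a = b := by
  linear_combination c.Linv * h - (a - b) * c.L_mul_Linv

theorem deriv_two (D : Derivation ℝ A A) : D 2 = 0 := by
  simpa using D.map_natCast 2

/-! ### Homogeneity -/

theorem g_symm (i j : Fin 2) : c.g i j = c.g j i := by
  rw [g, g, c.YY]

theorem two_g (i j : Fin 2) : 2 * c.g i j = c.Y i (c.Y j (c.L ^ 2)) := by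
  rw [g]; linear_combination c.Y i (c.Y j (c.L ^ 2)) * two_mul_half (A := A)

theorem deriv_sq (D : Derivation ℝ A A) : D (c.L ^ 2) = 2 * c.L * D c.L := by
  rw [pow_two, D.leibniz]; simp; ring

theorem liouville_L : c.liouville c.L = c.L := by
  rw [liouville_apply, c.euler]

theorem liouville_E : c.liouville (c.L ^ 2) = 2 * c.L ^ 2 := by
  rw [deriv_sq, liouville_L]; ring

theorem liouville_y (i : Fin 2) : c.liouville (c.y i) = c.y i := by
  rw [liouville_apply]; fin_cases i <;> simp [c.Yy]

theorem liouville_X (i : Fin 2) (f : A) : c.liouville (c.X i f) = c.X i (c.liouville f) := by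
  simp only [liouville_apply, map_add, Derivation.leibniz, c.Xy, c.YX, smul_eq_mul]; ring

theorem liouville_Y (i : Fin 2) (f : A) :
    c.liouville (c.Y i f) = c.Y i (c.liouville f) - c.Y i f := by
  simp only [liouville_apply, map_add, Derivation.leibniz, c.Yy, smul_eq_mul, c.YY i]
  fin_cases i <;> simp <;> ring

theorem liouville_EY (i : Fin 2) : c.liouville (c.Y i (c.L ^ 2)) = c.Y i (c.L ^ 2) := by
  rw [liouville_Y, liouville_E, Derivation.leibniz, deriv_two]; simp; ring

theorem liouville_g (i j : Fin 2) : c.liouville (c.g i j) = 0 := by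
  apply two_cancel
  have h : c.liouville (2 * c.g i j) = 0 := by
    rw [two_g, liouville_Y, liouville_EY]; ring
  rw [Derivation.leibniz, deriv_two] at h
  simpa using h

/-- Euler's identity for `∂L²/∂yʲ`, which has degree one. -/
theorem g_y (j : Fin 2) : c.g 0 j * c.y 0 + c.g 1 j * c.y 1 = c.L * c.Y j c.L := by
  apply two_cancel
  have h := c.liouville_EY j
  rw [liouville_apply, deriv_sq c (c.Y j)] at h
  rw [← deriv_sq] at h
  have h2 := c.deriv_sq (c.Y j)
  linear_combination h + h2 + c.y 0 * c.two_g 0 j + c.y 1 * c.two_g 1 j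

theorem s_sq' : c.s * c.s = c.g 0 0 * c.g 1 1 - c.g 0 1 * c.g 0 1 := by
  conv_rhs => rw [c.g_symm 0 1]
  rw [c.s_sq, g, g, g, c.YY 0 1]

theorem sinv_sq : c.sinv ^ 2 * (c.g 0 0 * c.g 1 1 - c.g 0 1 * c.g 0 1) = 1 := by
  linear_combination (c.s * c.sinv + 1) * c.s_mul_sinv - c.sinv ^ 2 * c.s_sq'

/-- Lowering the index removes the inverse metric; later arguments about the spray use this form of
its definition. -/
theorem g_G (i : Fin 2) : 4 * (c.g i 0 * c.G 0 + c.g i 1 * c.G 1) = c.b i := by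
  have h4 := four_mul_quarter (A := A)
  have h := c.sinv_sq
  have h10 := c.g_symm 1 0
  fin_cases i
  · simp [G, ginv, h10] at *
    linear_combination c.b 0 * h + c.b 0 * c.sinv ^ 2 * (c.g 0 0 * c.g 1 1 - c.g 0 1 * c.g 0 1) * h4
  · simp [G, ginv, h10] at *
    linear_combination c.b 1 * h + c.b 1 * c.sinv ^ 2 * (c.g 0 0 * c.g 1 1 - c.g 0 1 * c.g 0 1) * h4

theorem nondegenerate {u : Fin 2 → A} (h : ∀ i, c.g i 0 * u 0 + c.g i 1 * u 1 = 0) (i : Fin 2) :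
    u i = 0 := by
  have h0 := h 0
  have h1 := h 1
  have hs := c.sinv_sq
  rw [c.g_symm 1 0] at h1
  fin_cases i
  · change u 0 = 0
    linear_combination c.sinv ^ 2 * (c.g 1 1 * h0 - c.g 0 1 * h1) - u 0 * hs
  · change u 1 = 0
    linear_combination c.sinv ^ 2 * (c.g 0 0 * h1 - c.g 0 1 * h0) - u 1 * hs

theorem liouville_b (i : Fin 2) : c.liouville (c.b i) = 2 * c.b i := by
  simp only [b, map_sub, map_add, Derivation.leibniz, liouville_X, liouville_EY, liouville_y,
    liouville_E, smul_eq_mul, deriv_two]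
  ring

/-- In `g_G` the metric has degree zero and the right side degree two; nondegeneracy transfers the
degree to the spray coefficients. -/
theorem liouville_G (i : Fin 2) : c.liouville (c.G i) = 2 * c.G i := by
  have key := c.nondegenerate (u := fun i => c.liouville (c.G i) - 2 * c.G i) (fun i => by
    have h := congrArg c.liouville (c.g_G i)
    have h4 : c.liouville (4 : A) = 0 := by simpa using c.liouville.map_natCast 4
    simp only [map_add, Derivation.leibniz, liouville_g, smul_eq_mul, liouville_b, h4] at h
    have h' := c.g_G i
    linear_combination algebraMap ℝ A (1 / 4) * (h - 2 * h') -
      (c.g i 0 * (c.liouville (c.G 0) - 2 * c.G 0) + c.g i 1 * (c.liouville (c.G 1) - 2 * c.G 1))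
        * four_mul_quarter (A := A)) i
  linear_combination key

theorem N_y (i : Fin 2) : c.N i 0 * c.y 0 + c.N i 1 * c.y 1 = 2 * c.G i := by
  rw [← liouville_G, liouville_apply, N, N]; ring

/-! ### The spray preserves the Finsler function and its metric -/

/-- Conservation of energy: contract `g_G` with `y` and use Euler's identity for `∂L²/∂xⁱ`. -/
theorem S_E : c.S (c.L ^ 2) = 0 := by
  have h0 := c.g_G 0
  have h1 := c.g_G 1
  have k0 := c.g_y 0
  have k1 := c.g_y 1
  have e := c.liouville_E
  have x0 := congrArg (c.X 0) e
  have x1 := congrArg (c.X 1) e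
  rw [← liouville_X, liouville_apply, Derivation.leibniz, deriv_two] at x0 x1
  simp only [c.YX, smul_eq_mul] at x0 x1
  rw [S_apply, deriv_sq c (c.Y 0), deriv_sq c (c.Y 1)]
  rw [b] at h0 h1
  rw [c.g_symm 1 0] at *
  linear_combination 4 * (c.G 0 * k0 + c.G 1 * k1) - (c.y 0 * h0 + c.y 1 * h1)
    - (c.y 0 * x0 + c.y 1 * x1)

theorem S_L : c.S c.L = 0 := by
  apply two_cancel
  apply c.L_cancel
  have h := c.S_E
  rw [deriv_sq] at h
  linear_combination h

/-- Differentiating `S(L²) = 0` along `∂/∂yⁱ` and eliminating second derivatives with `g_G` shows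
that horizontal derivatives annihilate the energy. -/
theorem X_E (i : Fin 2) : c.X i (c.L ^ 2) =
    c.N 0 i * c.Y 0 (c.L ^ 2) + c.N 1 i * c.Y 1 (c.L ^ 2) := by
  have h := congrArg (c.Y i) c.S_E
  have hG := c.g_G i
  have t0 := c.two_g i 0
  have t1 := c.two_g i 1
  have y0 : c.y 0 * c.X 0 (c.Y i (c.L ^ 2)) + c.y 1 * c.X 1 (c.Y i (c.L ^ 2)) = c.b i
    + c.X i (c.L ^ 2) := by rw [b]; ring
  have y1 : c.X 0 (c.L ^ 2) * c.Y i (c.y 0) + c.X 1 (c.L ^ 2) * c.Y i (c.y 1)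
      = c.X i (c.L ^ 2) := by fin_cases i <;> simp [c.Yy]
  simp only [S_apply, map_add, map_sub, Derivation.leibniz, c.YX, smul_eq_mul, deriv_two,
    map_zero, ← t0, ← t1] at h
  apply two_cancel
  simp only [N]
  linear_combination h - y0 - y1 + hG

theorem X_L (i : Fin 2) : c.X i c.L = c.N 0 i * c.Y 0 c.L + c.N 1 i * c.Y 1 c.L := by
  apply two_cancel
  apply c.L_cancel
  have h := c.X_E i
  simp only [deriv_sq] at h
  linear_combination h

theorem H_L : c.H c.L = 0 := by
  rw [H_apply, X_L, X_L]; ring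

theorem V_L : c.V c.L = 0 := by
  simp [V_apply, m]; ring

theorem S_EY (i : Fin 2) : c.S (c.Y i (c.L ^ 2)) = c.X i (c.L ^ 2) := by
  have hG := c.g_G i
  rw [b] at hG
  rw [S_apply, c.YY 0 i, c.YY 1 i, ← two_g, ← two_g]
  linear_combination -hG

/-- The metric is parallel along the spray. Differentiating the Euler–Lagrange equations `S_EY` in
the fibre leaves mixed terms antisymmetric in `i, j`, which cancel on symmetrization. -/
theorem S_g (i j : Fin 2) : c.S (c.g i j) = c.N 0 j * c.g i 0 + c.N 1 j * c.g i 1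
    + c.N 0 i * c.g j 0 + c.N 1 i * c.g j 1 := by
  have key : ∀ i j, c.S (c.Y j (c.Y i (c.L ^ 2))) = 4 * (c.N 0 j * c.g i 0 + c.N 1 j * c.g i 1)
      + c.X i (c.Y j (c.L ^ 2)) - c.X j (c.Y i (c.L ^ 2)) := by
    intro i j
    have h := congrArg (c.Y j) (c.S_EY i)
    have y1 : c.X 0 (c.Y i (c.L ^ 2)) * c.Y j (c.y 0) + c.X 1 (c.Y i (c.L ^ 2)) * c.Y j (c.y 1)
      = c.X j (c.Y i (c.L ^ 2)) := by fin_cases j <;> simp [c.Yy]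
    have t0 := c.two_g i 0
    have t1 := c.two_g i 1
    rw [c.YY] at t0 t1
    simp only [S_apply, map_add, map_sub, Derivation.leibniz, c.YX, smul_eq_mul, deriv_two,
      c.YY j] at h
    rw [S_apply, c.YY j i]
    simp only [N]
    linear_combination h - y1 - 2 * c.Y j (c.G 0) * t0 - 2 * c.Y j (c.G 1) * t1
  have h1 := key i j
  have h2 := key j i
  rw [c.YY, ← two_g, Derivation.leibniz, deriv_two] at h1
  rw [← two_g, Derivation.leibniz, deriv_two] at h2
  simp only [smul_eq_mul] at h1 h2
  apply two_cancel
  apply two_cancel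
  linear_combination h1 + h2

/-! ### The Berwald frame -/

/-- A vector annihilated by `dL` is a multiple of `m`. -/
theorem exists_mul_m {w : Fin 2 → A} (h : w 0 * c.Y 0 c.L + w 1 * c.Y 1 c.L = 0) :
    ∃ a, ∀ i, w i = a * c.m i := by
  refine ⟨(c.y 0 * w 1 - c.y 1 * w 0) * c.Linv ^ 2 * c.s, fun i => ?_⟩
  have e := c.euler
  have hL := c.L_mul_Linv
  have hs := c.s_mul_sinv
  fin_cases i
  · have k : -(c.y 0 * w 1 - c.y 1 * w 0) * c.Y 1 c.L = c.L * w 0 := by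
      linear_combination w 0 * e - c.y 0 * h
    simp [m]
    linear_combination -w 0 * hL - c.Linv * k + c.Linv * ((c.y 0 * w 1 - c.y 1 * w 0) * c.Y 1 c.L)
      * (c.L * c.Linv * hs + hL)
  · have k : (c.y 0 * w 1 - c.y 1 * w 0) * c.Y 0 c.L = c.L * w 1 := by
      linear_combination w 1 * e - c.y 1 * h
    simp [m]
    linear_combination -w 1 * hL - c.Linv * k - c.Linv * ((c.y 0 * w 1 - c.y 1 * w 0) * c.Y 0 c.L)
      * (c.L * c.Linv * hs + hL)

theorem det_y_m : c.y 0 * c.m 1 - c.y 1 * c.m 0 = c.L ^ 2 * c.sinv := by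
  simp [m]
  linear_combination c.L * c.sinv * c.euler

theorem det_cancel {a b : A} (h : (c.y 0 * c.m 1 - c.y 1 * c.m 0) * a =
    (c.y 0 * c.m 1 - c.y 1 * c.m 0) * b) : a = b := by
  rw [det_y_m, mul_assoc, mul_assoc, pow_two, mul_assoc, mul_assoc] at h
  have h' := c.L_cancel (c.L_cancel h)
  linear_combination c.s * h' - (a - b) * c.s_mul_sinv

theorem y_m_independent {a b : A} (h : ∀ i, a * c.y i + b * c.m i = 0) : a = 0 ∧ b = 0 := by
  constructor <;> apply c.det_cancel
  · linear_combination c.m 1 * h 0 - c.m 0 * h 1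
  · linear_combination c.y 0 * h 1 - c.y 1 * h 0

theorem g_y_y : c.g 0 0 * c.y 0 * c.y 0 + 2 * c.g 0 1 * c.y 0 * c.y 1
    + c.g 1 1 * c.y 1 * c.y 1 = c.L ^ 2 := by
  have h0 := c.g_y 0
  have h1 := c.g_y 1
  rw [c.g_symm 1 0] at h0
  linear_combination c.y 0 * h0 + c.y 1 * h1 + c.L * c.euler

/-- The vector `m` is the covector `g(y, ·)` turned by a right angle and divided by `√det g`, so its
`g`-norm is that of `y`. -/
theorem g_m_m : c.g 0 0 * c.m 0 * c.m 0 + 2 * c.g 0 1 * c.m 0 * c.m 1 + c.g 1 1 * c.m 1 * c.m 1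
    = c.L ^ 2 := by
  have h0 := c.g_y 0
  have h1 := c.g_y 1
  have hs := c.sinv_sq
  have hE := c.g_y_y
  rw [c.g_symm 1 0] at h0
  have m0 : c.m 0 = -c.sinv * (c.g 0 1 * c.y 0 + c.g 1 1 * c.y 1) := by
    rw [h1]; simp [m]; ring
  have m1 : c.m 1 = c.sinv * (c.g 0 0 * c.y 0 + c.g 0 1 * c.y 1) := by
    rw [h0]; simp [m]; ring
  rw [m0, m1]
  linear_combination hE + (c.g 0 0 * c.y 0 * c.y 0 + 2 * c.g 0 1 * c.y 0 * c.y 1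
    + c.g 1 1 * c.y 1 * c.y 1) * hs

theorem m_dL : c.m 0 * c.Y 0 c.L + c.m 1 * c.Y 1 c.L = 0 := by
  simpa [V_apply] using c.V_L

theorem g_y_m : c.y 0 * (c.g 0 0 * c.m 0 + c.g 0 1 * c.m 1)
    + c.y 1 * (c.g 0 1 * c.m 0 + c.g 1 1 * c.m 1) = 0 := by
  have h0 := c.g_y 0
  have h1 := c.g_y 1
  rw [c.g_symm 1 0] at h0
  linear_combination c.m 0 * h0 + c.m 1 * h1 + c.L * c.m_dL

/-- Expansion in the `g`-orthogonal frame `(y, m)`: removing the `y`-part leaves a vector in the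
kernel of `dL`, and pairing with `m` reads off the other coefficient. -/
theorem decompose (w : Fin 2 → A) (i : Fin 2) :
    w i = (w 0 * c.Y 0 c.L + w 1 * c.Y 1 c.L) * c.Linv * c.y i
      + (w 0 * (c.g 0 0 * c.m 0 + c.g 0 1 * c.m 1) + w 1 * (c.g 0 1 * c.m 0 + c.g 1 1 * c.m 1))
        * c.Linv ^ 2 * c.m i := by
  have hL := c.L_mul_Linv
  obtain ⟨a, ha⟩ := c.exists_mul_m
    (w := fun i => w i - (w 0 * c.Y 0 c.L + w 1 * c.Y 1 c.L) * c.Linv * c.y i) (by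
      linear_combination -(w 0 * c.Y 0 c.L + w 1 * c.Y 1 c.L) * (c.Linv * c.euler + hL))
  have h0 := ha 0
  have h1 := ha 1
  have hi := ha i
  have hm := c.g_m_m
  have hy := c.g_y_m
  have k : w 0 * (c.g 0 0 * c.m 0 + c.g 0 1 * c.m 1) + w 1 * (c.g 0 1 * c.m 0 + c.g 1 1 * c.m 1)
      = a * c.L ^ 2 := by
    linear_combination (c.g 0 0 * c.m 0 + c.g 0 1 * c.m 1) * h0
      + (c.g 0 1 * c.m 0 + c.g 1 1 * c.m 1) * h1 + a * hm
      + (w 0 * c.Y 0 c.L + w 1 * c.Y 1 c.L) * c.Linv * hy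
  rw [k]
  linear_combination hi - a * c.m i * (c.L * c.Linv + 1) * hL

theorem S_YL (i : Fin 2) : c.S (c.Y i c.L) = c.X i c.L := by
  have h := c.S_EY i
  rw [deriv_sq, deriv_sq, Derivation.leibniz, Derivation.leibniz, S_L, deriv_two] at h
  simp only [smul_eq_mul] at h
  apply two_cancel
  apply c.L_cancel
  linear_combination h

/-- The field `m` is parallel along the spray. -/
theorem S_m (i : Fin 2) : c.S (c.m i) = -(c.N i 0 * c.m 0 + c.N i 1 * c.m 1) := by
  have h := c.decompose (fun i => c.S (c.m i) + (c.N i 0 * c.m 0 + c.N i 1 * c.m 1)) i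
  -- Differentiating `dL(m) = 0` kills the `y`-component of the covariant derivative of `m`, and
  -- differentiating `g(m, m) = L²` kills its `m`-component.
  have h1 := congrArg c.S c.m_dL
  have h2 := congrArg c.S c.g_m_m
  simp only [map_add, Derivation.leibniz, smul_eq_mul, S_YL, X_L, map_zero, S_E, deriv_two, S_g]
    at h1 h2
  have k1 : (c.S (c.m 0) + (c.N 0 0 * c.m 0 + c.N 0 1 * c.m 1)) * c.Y 0 c.L
    + (c.S (c.m 1) + (c.N 1 0 * c.m 0 + c.N 1 1 * c.m 1)) * c.Y 1 c.L = 0 := by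
    linear_combination h1
  have k2 : (c.S (c.m 0) + (c.N 0 0 * c.m 0 + c.N 0 1 * c.m 1)) *
      (c.g 0 0 * c.m 0 + c.g 0 1 * c.m 1)
    + (c.S (c.m 1) + (c.N 1 0 * c.m 0 + c.N 1 1 * c.m 1)) *
      (c.g 0 1 * c.m 0 + c.g 1 1 * c.m 1) = 0 := by
    apply two_cancel
    rw [c.g_symm 1 0] at h2
    linear_combination h2
  rw [k1, k2] at h
  linear_combination h

theorem main_eq : c.main = (∑ i, ∑ j, ∑ k, c.C i j k * c.m i * c.m j * c.m k) * c.Linv ^ 2 := rfl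

theorem two_C (i j k : Fin 2) : 2 * c.C i j k = c.Y k (c.g i j) := by
  rw [C]; linear_combination c.Y k (c.g i j) * two_mul_half (A := A)

/-- The `m`-component comes from applying `V` to `g(m, m) = L²`, where the derivative of `g`
produces the Cartan tensor. The value of `a` is never needed. -/
theorem V_m : ∃ a, ∀ i, c.V (c.m i) = a * c.y i - c.main * c.m i := by
  refine ⟨(c.V (c.m 0) * c.Y 0 c.L + c.V (c.m 1) * c.Y 1 c.L) * c.Linv, fun i => ?_⟩
  have h := c.decompose (fun i => c.V (c.m i)) i
  have hE : c.V (c.L ^ 2) = 0 := by rw [deriv_sq, V_L, mul_zero]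
  have h2 := congrArg c.V c.g_m_m
  simp only [map_add, Derivation.leibniz, smul_eq_mul, hE, deriv_two, c.V_apply (c.g _ _),
    ← two_C] at h2
  have k : c.V (c.m 0) * (c.g 0 0 * c.m 0 + c.g 0 1 * c.m 1)
      + c.V (c.m 1) * (c.g 0 1 * c.m 0 + c.g 1 1 * c.m 1)
      = -∑ i, ∑ j, ∑ k, c.C i j k * c.m i * c.m j * c.m k := by
    simp only [Fin.sum_univ_two]
    have h01 : ∀ k, c.C 1 0 k = c.C 0 1 k := fun k => by rw [C, C, g_symm]
    simp only [h01]
    apply two_cancel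
    linear_combination h2
  rw [h, k, main_eq]
  ring

/-! ### The structure equations -/

/-- Since `V(yⁱ) = mⁱ`, the bracket has horizontal part `m`; parallelism of `m` turns its vertical
part into that of `H`. -/
theorem V_S (f : A) : c.V (c.S f) - c.S (c.V f) = c.H f := by
  have y0 (i : Fin 2) : c.V (c.y i) = c.m i := by
    rw [V_apply]; fin_cases i <;> simp [c.Yy]
  have hm := c.S_m
  rw [c.S_apply f, c.V_apply f, c.H_apply f]
  simp only [map_add, map_sub, Derivation.leibniz, smul_eq_mul, y0, hm, deriv_two]
  simp only [V_apply, S_apply, c.YX, c.YY 1 0, N]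
  ring

/-- Apply `S` to the homogeneity relation `N_y`. -/
theorem R_y (i : Fin 2) : c.R i 0 * c.y 0 + c.R i 1 * c.y 1 = 0 := by
  have h := congrArg c.S (c.N_y i)
  have y0 : c.S (c.y 0) = -2 * c.G 0 := by simp [S_apply, c.Yy, c.Xy]
  have y1 : c.S (c.y 1) = -2 * c.G 1 := by simp [S_apply, c.Yy, c.Xy]
  simp only [map_add, Derivation.leibniz, smul_eq_mul, y0, y1, deriv_two] at h
  rw [c.S_apply (c.G i)] at h
  have h0 := c.N_y 0
  have h1 := c.N_y 1
  simp only [R]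
  simp only [N] at *
  linear_combination -h - c.Y 0 (c.G i) * h0 - c.Y 1 (c.G i) * h1

theorem S_H_aux (f : A) : c.S (c.H f) - c.H (c.S f) =
    (c.R 0 0 * c.m 0 + c.R 0 1 * c.m 1) * c.Y 0 f
    + (c.R 1 0 * c.m 0 + c.R 1 1 * c.m 1) * c.Y 1 f := by
  have y0 : c.H (c.y 0) = -(c.N 0 0 * c.m 0 + c.N 0 1 * c.m 1) := by simp [H_apply, c.Yy, c.Xy]
  have y1 : c.H (c.y 1) = -(c.N 1 0 * c.m 0 + c.N 1 1 * c.m 1) := by simp [H_apply, c.Yy, c.Xy]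
  have hm := c.S_m
  rw [c.S_apply f, c.H_apply f]
  simp only [map_add, map_sub, Derivation.leibniz, smul_eq_mul, y0, y1, hm, deriv_two, R]
  simp only [H_apply, c.S_apply (c.X _ _), c.S_apply (c.Y _ _), c.YX, c.YY 1 0, c.XX 1 0]
  simp only [← N.eq_def]
  ring

/-- Both `S` and `H` annihilate `L`, hence so does their bracket, and `R m` is a multiple of `m`. As
`R y = 0`, the factor is the trace. -/
theorem R_m (i : Fin 2) : c.R i 0 * c.m 0 + c.R i 1 * c.m 1 = c.ricci * c.m i := by
  have h := c.S_H_aux c.L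
  rw [H_L, S_L, map_zero, map_zero] at h
  obtain ⟨a, ha⟩ := c.exists_mul_m (w := fun i => c.R i 0 * c.m 0 + c.R i 1 * c.m 1)
    (by linear_combination -h)
  have h0 := ha 0
  have h1 := ha 1
  have k : c.ricci = a := by
    apply c.det_cancel
    simp only [ricci]
    linear_combination c.m 1 * c.R_y 0 - c.m 0 * c.R_y 1 + c.y 0 * h1 - c.y 1 * h0
  rw [k]
  exact ha i

theorem S_H (f : A) : c.S (c.H f) - c.H (c.S f) = c.ricci * c.V f := by
  rw [S_H_aux, R_m, R_m, V_apply]; ring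

/-- The horizontal part of the bracket is `-V(m)`, known from `V_m`. The vertical remainder
annihilates `L`, so it is a multiple of `V`; the Jacobi identity will determine `b`. -/
theorem H_V : ∃ a b, ∀ f, c.H (c.V f) - c.V (c.H f) = a * c.S f + c.main * c.H f + b * c.V f := by
  obtain ⟨a, ha⟩ := c.V_m
  have key : ∃ w : Fin 2 → A, ∀ f, c.H (c.V f) - c.V (c.H f) =
      -a * c.S f + c.main * c.H f + (w 0 * c.Y 0 f + w 1 * c.Y 1 f) := by
    refine ⟨fun i => c.H (c.m i) + c.V (c.N i 0 * c.m 0 + c.N i 1 * c.m 1)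
      - 2 * a * c.G i + c.main * (c.N i 0 * c.m 0 + c.N i 1 * c.m 1), fun f => ?_⟩
    rw [c.V_apply f, c.H_apply f, c.S_apply f]
    simp only [map_add, map_sub, Derivation.leibniz, smul_eq_mul, ha]
    simp only [H_apply, c.V_apply (c.X _ _), c.V_apply (c.Y _ _), c.YX, c.YY 1 0]
    ring
  obtain ⟨w, hw⟩ := key
  have hL := hw c.L
  rw [V_L, H_L, S_L, map_zero, map_zero] at hL
  obtain ⟨b, hb⟩ := c.exists_mul_m (w := w) (by linear_combination -hL)
  refine ⟨-a, b, fun f => ?_⟩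
  rw [hw, hb, hb, V_apply]
  ring

/-- The Bianchi identity. -/
theorem bianchi : c.S (c.S c.main) + c.main * c.ricci + c.V c.ricci = 0 := by
  obtain ⟨a, b, hab⟩ := c.H_V
  -- The Jacobi identity for `S, H, V` with the three brackets inserted.
  have key : ∀ f, c.S a * c.S f + (c.S c.main - b) * c.H f
      + (c.S b + c.main * c.ricci + c.V c.ricci) * c.V f = 0 := by
    intro f
    have e1 := congrArg c.S (hab f)
    have e2 := hab (c.S f)
    have e3 := congrArg c.V (c.S_H f)
    have e4 := congrArg c.H (c.V_S f)
    have e5 := c.S_H (c.V f)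
    have e6 := c.V_S (c.H f)
    have e7 := c.S_H f
    have e8 := c.V_S f
    simp only [map_add, map_sub, Derivation.leibniz, smul_eq_mul] at e1 e2 e3 e4 e5 e6
    linear_combination e2 - e1 - e3 - e4 + e5 + e6 - c.main * e7 + b * e8
  -- On the base coordinates `V` vanishes, which isolates the coefficients of `S` and `H`; the fibre
  -- coordinates then isolate that of `V`.
  have hx := c.y_m_independent (a := c.S a) (b := c.S c.main - b) (fun i => by
    have h := key (c.x i)
    have h1 : c.S (c.x i) = c.y i := by
      rw [S_apply]; fin_cases i <;> simp [c.Xx, c.Yx]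
    have h2 : c.H (c.x i) = c.m i := by
      rw [H_apply]; fin_cases i <;> simp [c.Xx, c.Yx]
    have h3 : c.V (c.x i) = 0 := by
      rw [V_apply]; simp [c.Yx]
    rw [h1, h2, h3] at h
    linear_combination h)
  have hb : c.S c.main = b := by linear_combination hx.2
  refine (c.y_m_independent (a := 0) fun i => ?_).2
  have h := key (c.y i)
  have h3 : c.V (c.y i) = c.m i := by
    rw [V_apply]; fin_cases i <;> simp [c.Yy]
  rw [hx.1, hx.2, h3, ← hb] at h
  linear_combination h

theorem C_y (i j : Fin 2) : c.C i j 0 * c.y 0 + c.C i j 1 * c.y 1 = 0 := by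
  apply two_cancel
  have h := c.liouville_g i j
  rw [liouville_apply, ← two_C, ← two_C] at h
  linear_combination h

theorem C_symm (i j k : Fin 2) : c.C i j k = c.C i k j := by
  apply two_cancel
  apply two_cancel
  have aux : ∀ i j k, 2 * (2 * c.C i j k) = c.Y k (c.Y i (c.Y j (c.L ^ 2))) := by
    intro i j k
    rw [← two_g, two_C, Derivation.leibniz, deriv_two]
    simp
  rw [aux, aux, c.YY k i, c.YY j i, c.YY j k]

theorem C_symm' (i j k : Fin 2) : c.C i j k = c.C j i k := by
  rw [C, C, g_symm]

/-- A covector annihilating `y` is determined by its value on `m`. -/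
theorem exists_dual (i : Fin 2) : ∃ μ, ∀ κ : Fin 2 → A, κ 0 * c.y 0 + κ 1 * c.y 1 = 0 →
    κ i = μ * (κ 0 * c.m 0 + κ 1 * c.m 1) := by
  refine ⟨c.Linv ^ 2 * c.s * (if i = 0 then -c.y 1 else c.y 0), fun κ h => ?_⟩
  apply c.det_cancel
  have hs : (c.y 0 * c.m 1 - c.y 1 * c.m 0) * (c.Linv ^ 2 * c.s) = 1 := by
    rw [det_y_m]
    linear_combination (c.L ^ 2 * c.Linv ^ 2) * c.s_mul_sinv + (c.L * c.Linv + 1) * c.L_mul_Linv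
  fin_cases i
  · simp
    linear_combination c.m 1 * h + c.y 1 * (κ 0 * c.m 0 + κ 1 * c.m 1) * hs
  · simp
    linear_combination -c.m 0 * h - c.y 0 * (κ 0 * c.m 0 + κ 1 * c.m 1) * hs

/-- The Cartan tensor is a multiple of the main scalar. -/
theorem C_eq (i j k : Fin 2) : ∃ a, c.C i j k = a * c.main := by
  obtain ⟨a, ha⟩ := c.exists_dual i
  obtain ⟨b, hb⟩ := c.exists_dual j
  obtain ⟨d, hd⟩ := c.exists_dual k
  -- The indices are contracted with `m` one at a time; each intermediate covector annihilates `y`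
  -- by `C_y` and the symmetry of `C`.
  have h1 := hd (fun k => c.C i j k) (c.C_y i j)
  have h2 := hb (fun j => c.C i j 0 * c.m 0 + c.C i j 1 * c.m 1) (by
    have e0 := c.C_y i 0
    have e1 := c.C_y i 1
    rw [c.C_symm i 1 0]
    rw [c.C_symm i 1 0] at e1
    linear_combination c.m 0 * e0 + c.m 1 * e1)
  have h3 := ha (fun i => (c.C i 0 0 * c.m 0 + c.C i 0 1 * c.m 1) * c.m 0
      + (c.C i 1 0 * c.m 0 + c.C i 1 1 * c.m 1) * c.m 1) (by
    have e0 := c.C_y 0 0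
    have e1 := c.C_y 0 1
    have e2 := c.C_y 1 1
    simp only [c.C_symm' 1 0, c.C_symm 0 1 0, c.C_symm 1 1 0] at *
    linear_combination c.m 0 * c.m 0 * e0 + 2 * c.m 0 * c.m 1 * e1 + c.m 1 * c.m 1 * e2)
  have h4 : c.main * c.L ^ 2 = ∑ i, ∑ j, ∑ k, c.C i j k * c.m i * c.m j * c.m k := by
    rw [main_eq]
    linear_combination (∑ i, ∑ j, ∑ k, c.C i j k * c.m i * c.m j * c.m k)
      * (c.L * c.Linv + 1) * c.L_mul_Linv
  refine ⟨d * b * a * c.L ^ 2, ?_⟩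
  rw [h1, h2, h3, mul_assoc _ (c.L ^ 2), mul_comm (c.L ^ 2), h4]
  simp only [Fin.sum_univ_two]
  ring

/-! ### Vanishing of the main scalar -/

/-- Modulo `I`, Bianchi reads `𝓘 (ρ - 1) ≡ 0`. Applying `V` and multiplying by `𝓘` leaves `𝓘² V(ρ) ≡
-𝓘³`. -/
theorem main_mem_of_S_S_main_mem {I : Ideal A} (hI : I.IsRadical)
    (hVI : ∀ f ∈ I, c.V f ∈ I) (hV : c.V c.ricci + c.main ∈ I) (hS : c.S (c.S c.main) ∈ I) :
    c.main ∈ I := by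
  have h1 : c.main * (c.ricci - 1) ∈ I := by
    rw [show c.main * (c.ricci - 1) = -(c.V c.ricci + c.main) - c.S (c.S c.main) by
      linear_combination c.bianchi]
    exact I.sub_mem (I.neg_mem hV) hS
  have h2 := hVI _ h1
  refine hI ⟨3, ?_⟩
  rw [show c.main ^ 3 = c.main ^ 2 * (c.V c.ricci + c.main)
      - (c.main * c.V (c.main * (c.ricci - 1)) - c.V c.main * (c.main * (c.ricci - 1))) by
    simp only [Derivation.leibniz, map_sub, Derivation.map_one_eq_zero, smul_eq_mul]; ring]
  exact I.sub_mem (I.mul_mem_left _ hV) (I.sub_mem (I.mul_mem_left _ h2) (I.mul_mem_left _ h1))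

/-- The brackets applied to `ρ` give `H(ρ) ≡ S(𝓘)` and then `S(S(𝓘)) ≡ ρ V(ρ)`. In Bianchi the terms
with factor `ρ` cancel, so no radical is needed. -/
theorem main_mem_of_S_ricci_mem {I : Ideal A} (hSI : ∀ f ∈ I, c.S f ∈ I)
    (hHI : ∀ f ∈ I, c.H f ∈ I) (hVI : ∀ f ∈ I, c.V f ∈ I)
    (hV : c.V c.ricci + c.main ∈ I) (hS : c.S c.ricci ∈ I) : c.main ∈ I := by
  have h1 := hVI _ hS
  have h2 := hSI _ hV
  have h3 := hSI _ (I.sub_mem h1 h2)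
  have h4 := hHI _ hS
  have e1 := c.V_S c.ricci
  have e2 := c.S_H c.ricci
  rw [show c.V (c.S c.ricci) - c.S (c.V c.ricci + c.main) = c.H c.ricci - c.S c.main by
    rw [map_add]; linear_combination e1, map_sub] at h3
  rw [show c.main = c.H (c.S c.ricci) + c.ricci * (c.V c.ricci + c.main) + (c.V c.ricci + c.main)
      - (c.S (c.H c.ricci) - c.S (c.S c.main)) by linear_combination e2 - c.bianchi]
  exact I.sub_mem (I.add_mem (I.add_mem h4 (I.mul_mem_left _ hV)) hV) h3

end Calculus

/-! ### The algebra of smooth functions on an open set -/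

section SmoothFunctions

variable {W : Type*}

/-- The extension by zero of a function on a subset. -/
def extendZero {Ω : Set W} (f : Ω → ℝ) : W → ℝ := Function.extend Subtype.val f 0

theorem extendZero_apply {Ω : Set W} (f : Ω → ℝ) (p : Ω) : extendZero f p = f p :=
  Subtype.val_injective.extend_apply f 0 p

variable [NormedAddCommGroup W] [NormedSpace ℝ W]

/-- The algebra of smooth functions on a subset. -/
def smoothFunctions (Ω : Set W) : Subalgebra ℝ (Ω → ℝ) where
  carrier := {f | ContDiffOn ℝ ∞ (extendZero f) Ω}
  mul_mem' {f g} hf hg := (hf.mul hg).congr fun p hp => by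
    simp [extendZero_apply _ (⟨p, hp⟩ : Ω)]
  add_mem' {f g} hf hg := (hf.add hg).congr fun p hp => by
    simp [extendZero_apply _ (⟨p, hp⟩ : Ω)]
  algebraMap_mem' r := (contDiffOn_const (c := r)).congr fun p hp => by
    simp [extendZero_apply _ (⟨p, hp⟩ : Ω)]

/-- The element `a` is the restriction of the function `f`. -/
def Represents {Ω : Set W} (a : smoothFunctions Ω) (f : W → ℝ) : Prop :=
  ∀ p : Ω, a.1 p = f p

/-- The restriction to `Ω` of a function that is smooth on `Ω`. -/
def restrictSmooth {Ω : Set W} (f : W → ℝ) (hf : ContDiffOn ℝ ∞ f Ω) : smoothFunctions Ω :=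
  ⟨fun p => f p, hf.congr fun p hp => extendZero_apply _ (⟨p, hp⟩ : Ω)⟩

theorem represents_restrictSmooth {Ω : Set W} (f : W → ℝ) (hf : ContDiffOn ℝ ∞ f Ω) :
    Represents (restrictSmooth f hf) f := fun _ => rfl

namespace Represents

variable {Ω : Set W} {a b : smoothFunctions Ω} {f g : W → ℝ}

/-- Openness makes derivatives on `Ω` independent of the values chosen outside. -/
theorem eventuallyEq (h : Represents a f) (hΩ : IsOpen Ω) {p : W} (hp : p ∈ Ω) :
    extendZero a.1 =ᶠ[nhds p] f := by
  filter_upwards [hΩ.mem_nhds hp] with q hq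
  exact (extendZero_apply a.1 (⟨q, hq⟩ : Ω)).trans (h ⟨q, hq⟩)

theorem contDiffOn (h : Represents a f) : ContDiffOn ℝ ∞ f Ω :=
  ContDiffOn.congr a.2 fun p hp =>
    ((extendZero_apply a.1 (⟨p, hp⟩ : Ω)).trans (h ⟨p, hp⟩)).symm

theorem add (hf : Represents a f) (hg : Represents b g) :
    Represents (a + b) (fun p => f p + g p) := fun p => by
  simp [← hf p, ← hg p]

theorem sub (hf : Represents a f) (hg : Represents b g) :
    Represents (a - b) (fun p => f p - g p) := fun p => by
  simp [← hf p, ← hg p]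

theorem mul (hf : Represents a f) (hg : Represents b g) :
    Represents (a * b) (fun p => f p * g p) := fun p => by
  simp [← hf p, ← hg p]

theorem neg (hf : Represents a f) : Represents (-a) (fun p => -f p) := fun p => by
  simp [← hf p]

theorem pow (hf : Represents a f) (n : ℕ) : Represents (a ^ n) (fun p => f p ^ n) := fun p => by
  simp [← hf p]

theorem const (r : ℝ) : Represents (algebraMap ℝ (smoothFunctions Ω) r) (fun _ => r) :=
  fun _ => rfl

theorem ofNat (n : ℕ) [n.AtLeastTwo] :
    Represents (OfNat.ofNat n : smoothFunctions Ω) (fun _ => OfNat.ofNat n) :=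
  fun _ => rfl

theorem congr (h : Represents a f) (hfg : ∀ p ∈ Ω, f p = g p) : Represents a g :=
  fun p => (h p).trans (hfg p p.2)

theorem unique (hf : Represents a f) (hg : Represents b f) : a = b :=
  Subtype.ext (funext fun p => (hf p).trans (hg p).symm)

end Represents

theorem represents_extendZero {Ω : Set W} (a : smoothFunctions Ω) :
    Represents a (extendZero a.1) := fun p => (extendZero_apply a.1 p).symm

/-- The derivative in a constant direction, as a derivation. -/
def directional {Ω : Set W} (hΩ : IsOpen Ω) (v : W) :
    Derivation ℝ (smoothFunctions Ω) (smoothFunctions Ω) :=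
  have hd (a : smoothFunctions Ω) (p : Ω) : DifferentiableAt ℝ (extendZero a.1) p :=
    (ContDiffOn.contDiffAt a.2 (hΩ.mem_nhds p.2)).differentiableAt (by simp)
  Derivation.mk'
    { toFun := fun a => restrictSmooth (fun p => fderiv ℝ (extendZero a.1) p v)
        ((ContDiffOn.fderiv_of_isOpen a.2 hΩ (m := ∞) (by simp)).clm_apply contDiffOn_const)
      map_add' := fun a b => Subtype.ext <| funext fun p => by
        have h := (((represents_extendZero a).add (represents_extendZero b)).eventuallyEq hΩ p.2)
        simp only [restrictSmooth, h.fderiv_eq]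
        rw [fderiv_fun_add (hd a p) (hd b p)]
        rfl
      map_smul' := fun r a => Subtype.ext <| funext fun p => by
        have h := (((Represents.const r).mul (represents_extendZero a)).eventuallyEq hΩ p.2)
        rw [← Algebra.smul_def] at h
        simp only [restrictSmooth, h.fderiv_eq]
        rw [fderiv_const_mul (hd a p)]
        rfl }
    (fun a b => Subtype.ext <| funext fun p => by
      have h := (((represents_extendZero a).mul (represents_extendZero b)).eventuallyEq hΩ p.2)
      simp only [restrictSmooth, LinearMap.coe_mk, AddHom.coe_mk, h.fderiv_eq]
      rw [fderiv_fun_mul (hd a p) (hd b p)]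
      simp [extendZero_apply])

theorem Represents.directional {Ω : Set W} {a : smoothFunctions Ω} {f : W → ℝ}
    (h : Represents a f) (hΩ : IsOpen Ω) (v : W) :
    Represents (directional hΩ v a) (fun p => fderiv ℝ f p v) := fun p => by
  change fderiv ℝ (extendZero a.1) p v = _
  rw [(h.eventuallyEq hΩ p.2).fderiv_eq]

theorem directional_comm {Ω : Set W} (hΩ : IsOpen Ω) (v w : W) (a : smoothFunctions Ω) :
    directional hΩ v (directional hΩ w a) = directional hΩ w (directional hΩ v a) := by
  have ha := represents_extendZero a
  have key (v w : W) (p : W) (hp : p ∈ Ω) :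
      fderiv ℝ (fun p => fderiv ℝ (extendZero a.1) p w) p v
      = fderiv ℝ (fderiv ℝ (extendZero a.1)) p v w := by
    have hd : DifferentiableAt ℝ (fderiv ℝ (extendZero a.1)) p :=
      ((ContDiffOn.fderiv_of_isOpen a.2 hΩ (m := ∞) (by simp)).contDiffAt
        (hΩ.mem_nhds hp)).differentiableAt (by simp)
    rw [fderiv_clm_apply hd (differentiableAt_const _)]
    simp
  refine ((ha.directional hΩ w).directional hΩ v).unique
    (((ha.directional hΩ v).directional hΩ w).congr fun p hp => ?_)
  rw [key _ _ _ hp, key _ _ _ hp]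
  have hs : IsSymmSndFDerivAt ℝ (extendZero a.1) p :=
    (ContDiffOn.contDiffAt a.2 (hΩ.mem_nhds hp)).isSymmSndFDerivAt
      (by simpa using WithTop.coe_le_coe.2 (le_top : (2 : ℕ∞) ≤ ⊤))
  exact hs w v

end SmoothFunctions

/-! ### Positivity of the metric determinant -/

/-- The second-order necessary condition for a local minimum. -/
theorem second_deriv_nonneg_of_isLocalMin {φ ψ : ℝ → ℝ} {d x : ℝ} (hmin : IsLocalMin φ x)
    (hφ : ∀ᶠ t in nhds x, HasDerivAt φ (ψ t) t) (hψ : HasDerivAt ψ d x) : 0 ≤ d := by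
  by_contra! hd
  have hderiv : deriv φ =ᶠ[nhds x] ψ := hφ.mono fun t ht => ht.deriv
  have h2 : deriv (deriv φ) x = d := by rw [hderiv.deriv_eq, hψ.deriv]
  -- A negative second derivative would also give a local maximum; `φ` would be locally constant and
  -- `d` zero.
  have hmax : IsLocalMax φ x := isLocalMax_of_deriv_deriv_neg (by rwa [h2]) hmin.deriv_eq_zero
    hφ.self_of_nhds.continuousAt
  have hconst : φ =ᶠ[nhds x] fun _ => φ x := by
    filter_upwards [hmin, hmax] with t h1 h2
    exact le_antisymm h2 h1
  have h3 : deriv φ =ᶠ[nhds x] fun _ => 0 := by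
    filter_upwards [hconst.eventuallyEq_nhds] with t ht
    rw [ht.deriv_eq, deriv_const]
  rw [h3.deriv_eq, deriv_const] at h2
  exact hd.ne h2.symm

theorem plane_eq (v : Plane) : v = v 0 • EuclideanSpace.single 0 (1 : ℝ)
    + v 1 • EuclideanSpace.single 1 (1 : ℝ) := by
  ext i; fin_cases i <;> simp

theorem fderiv_eq_dx_dy (f : Plane × Plane → ℝ) (p w : Plane × Plane) :
    fderiv ℝ f p w = w.1 0 * dx 0 f p + w.1 1 * dx 1 f p + w.2 0 * dy 0 f p + w.2 1 * dy 1 f p := by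
  have hw : w = w.1 0 • (EuclideanSpace.single 0 (1 : ℝ), (0 : Plane))
      + w.1 1 • (EuclideanSpace.single 1 (1 : ℝ), (0 : Plane))
      + w.2 0 • ((0 : Plane), EuclideanSpace.single 0 (1 : ℝ))
      + w.2 1 • ((0 : Plane), EuclideanSpace.single 1 (1 : ℝ)) := by
    refine Prod.ext ?_ ?_
    · simpa using plane_eq w.1
    · simpa using plane_eq w.2
  conv_lhs => rw [hw]
  simp only [map_add, map_smul, dx, dy, smul_eq_mul]

/-- The slit tangent bundle of `U`. -/
def slit (U : Set Plane) : Set (Plane × Plane) := U ×ˢ {0}ᶜ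

/-- `L` is a Finsler function over `U`, except that its metric may be indefinite. -/
structure IsPreFinslerOn (U : Set Plane) (L : Plane × Plane → ℝ) : Prop where
  isOpen : IsOpen U
  smooth : ContDiffOn ℝ ∞ L (slit U)
  pos : ∀ x ∈ U, ∀ y : Plane, y ≠ 0 → 0 < L (x, y)
  homog : ∀ x ∈ U, ∀ y : Plane, y ≠ 0 → ∀ t : ℝ, 0 < t → L (x, t • y) = t * L (x, y)

namespace IsPreFinslerOn

variable {U : Set Plane} {L : Plane × Plane → ℝ}

theorem isOpen_slit (h : IsPreFinslerOn U L) : IsOpen (slit U) :=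
  h.isOpen.prod isOpen_compl_singleton

theorem represents (h : IsPreFinslerOn U L) : Represents (restrictSmooth L h.smooth) L :=
  represents_restrictSmooth L h.smooth

theorem smooth_dy {f : Plane × Plane → ℝ} (h : IsPreFinslerOn U L)
    (hf : ContDiffOn ℝ ∞ f (slit U)) (i : Fin 2) : ContDiffOn ℝ ∞ (dy i f) (slit U) :=
  ((represents_restrictSmooth f hf).directional h.isOpen_slit _).contDiffOn

theorem metricTensor_symm (h : IsPreFinslerOn U L) {p : Plane × Plane} (hp : p ∈ slit U) :
    metricTensor L p 0 1 = metricTensor L p 1 0 := by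
  have hE := h.represents.pow 2
  have h1 := ((hE.directional h.isOpen_slit (0, EuclideanSpace.single 1 (1 : ℝ))).directional
    h.isOpen_slit (0, EuclideanSpace.single 0 (1 : ℝ))) ⟨p, hp⟩
  have h2 := ((hE.directional h.isOpen_slit (0, EuclideanSpace.single 0 (1 : ℝ))).directional
    h.isOpen_slit (0, EuclideanSpace.single 1 (1 : ℝ))) ⟨p, hp⟩
  rw [directional_comm, h2] at h1
  change (1 / 2 : ℝ) * _ = (1 / 2 : ℝ) * _
  rw [dy, dy]
  exact congrArg _ h1.symm

theorem smooth_metricTensor (h : IsPreFinslerOn U L) (i j : Fin 2) :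
    ContDiffOn ℝ ∞ (fun p => metricTensor L p i j) (slit U) :=
  contDiffOn_const.mul (h.smooth_dy (h.smooth_dy (h.smooth.pow 2) j) i)

theorem hasDerivAt_fibre (h : IsPreFinslerOn U L) {x y : Plane} {f : Plane × Plane → ℝ}
    (hf : ContDiffOn ℝ ∞ f (slit U)) (v : Plane) (t : ℝ) (hp : (x, y + t • v) ∈ slit U) :
    HasDerivAt (fun t : ℝ => f (x, y + t • v))
      (v 0 * dy 0 f (x, y + t • v) + v 1 * dy 1 f (x, y + t • v)) t := by
  have hd : HasFDerivAt f (fderiv ℝ f (x, y + t • v)) (x, y + t • v) :=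
    ((hf.contDiffAt (h.isOpen_slit.mem_nhds hp)).differentiableAt (by simp)).hasFDerivAt
  have hl : HasDerivAt (fun t : ℝ => (x, y + t • v)) ((0 : Plane), v) t := by
    refine (hasDerivAt_const _ _).prodMk ?_
    simpa using ((hasDerivAt_id t).smul_const v).const_add y
  exact (hd.comp_hasDerivAt t hl).congr_deriv (by rw [fderiv_eq_dx_dy]; simp)

/-- If `c` is the minimum of `L²` on the unit circle, attained at `y`, homogeneity gives `L² ≥ c
‖·‖²` off the origin with equality at `y`. Comparing Hessians there gives `g ≥ c · id`. -/
theorem exists_det_pos (h : IsPreFinslerOn U L) {x : Plane} (hx : x ∈ U) :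
    ∃ y : Plane, y ≠ 0 ∧ 0 < (metricTensor L (x, y)).det := by
  have hcont : ContinuousOn (fun y : Plane => L (x, y) ^ 2) {0}ᶜ :=
    (h.smooth.continuousOn.comp (by fun_prop) (fun y hy => ⟨hx, hy⟩)).pow 2
  have hne : ∀ y : Plane, y ∈ Metric.sphere (0 : Plane) 1 → y ≠ 0 := fun y hy h0 => by
    simp [h0] at hy
  obtain ⟨y, hy, hmin⟩ := (isCompact_sphere (0 : Plane) 1).exists_isMinOn
    (by exact NormedSpace.sphere_nonempty.2 zero_le_one) (hcont.mono hne)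
  have hy0 := hne y hy
  have hy1 : ‖y‖ = 1 := by simpa using hy
  have hc : 0 < L (x, y) ^ 2 := pow_pos (h.pos x hx y hy0) 2
  set c := L (x, y) ^ 2 with hcdef
  have hbound : ∀ z : Plane, z ≠ 0 → c * ‖z‖ ^ 2 ≤ L (x, z) ^ 2 := by
    intro z hz
    have hz' : 0 < ‖z‖ := norm_pos_iff.2 hz
    have hu : ‖‖z‖⁻¹ • z‖ = 1 := by rw [norm_smul, norm_inv, norm_norm, inv_mul_cancel₀ hz'.ne']
    have h1 : c ≤ L (x, ‖z‖⁻¹ • z) ^ 2 := hmin (by simpa using hu)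
    rw [h.homog x hx z hz _ (inv_pos.2 hz'), mul_pow, inv_pow] at h1
    have h2 : 0 < ‖z‖ ^ 2 := by positivity
    calc c * ‖z‖ ^ 2 ≤ ((‖z‖ ^ 2)⁻¹ * L (x, z) ^ 2) * ‖z‖ ^ 2 := by gcongr
      _ = L (x, z) ^ 2 := by field_simp
  have hp : (x, y) ∈ slit U := ⟨hx, hy0⟩
  have hE : ContDiffOn ℝ ∞ (fun q => L q ^ 2) (slit U) := h.smooth.pow 2
  have hess : ∀ v : Plane, c * (v 0 ^ 2 + v 1 ^ 2) ≤
      v 0 * (v 0 * metricTensor L (x, y) 0 0 + v 1 * metricTensor L (x, y) 1 0)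
      + v 1 * (v 0 * metricTensor L (x, y) 0 1 + v 1 * metricTensor L (x, y) 1 1) := by
    intro v
    have hnear : ∀ᶠ t : ℝ in nhds 0, (x, y + t • v) ∈ slit U := by
      have : ContinuousAt (fun t : ℝ => (x, y + t • v)) 0 := by fun_prop
      exact this (by simpa using h.isOpen_slit.mem_nhds hp)
    have hq : ∀ z : Plane, ‖z‖ ^ 2 = z 0 ^ 2 + z 1 ^ 2 := fun z => by
      simp [EuclideanSpace.norm_sq_eq]
    have hlin : ∀ (i : Fin 2) (t : ℝ), HasDerivAt (fun t : ℝ => y i + t * v i) (v i) t :=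
      fun i t => by simpa using ((hasDerivAt_id t).mul_const (v i)).const_add (y i)
    have key := second_deriv_nonneg_of_isLocalMin (x := (0 : ℝ))
      (φ := fun t => L (x, y + t • v) ^ 2 - c * ((y 0 + t * v 0) ^ 2 + (y 1 + t * v 1) ^ 2))
      (ψ := fun t => (v 0 * dy 0 (fun q => L q ^ 2) (x, y + t • v)
        + v 1 * dy 1 (fun q => L q ^ 2) (x, y + t • v))
        - c * (2 * (y 0 + t * v 0) * v 0 + 2 * (y 1 + t * v 1) * v 1))
      (d := (v 0 * (v 0 * dy 0 (dy 0 (fun q => L q ^ 2)) (x, y)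
          + v 1 * dy 1 (dy 0 (fun q => L q ^ 2)) (x, y))
        + v 1 * (v 0 * dy 0 (dy 1 (fun q => L q ^ 2)) (x, y)
          + v 1 * dy 1 (dy 1 (fun q => L q ^ 2)) (x, y)))
        - c * (2 * v 0 * v 0 + 2 * v 1 * v 1)) ?_ ?_ ?_
    · simp only [metricTensor, Matrix.of_apply]
      linarith
    · filter_upwards [hnear] with t ht
      have := hbound _ ht.2
      rw [hq] at this
      have e := hq y
      rw [hy1] at e
      simp at this ⊢
      rw [← e]
      linarith
    · filter_upwards [hnear] with t ht
      have h1 := h.hasDerivAt_fibre hE v t ht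
      refine h1.sub (HasDerivAt.const_mul c (((hlin 0 t).pow 2).add ((hlin 1 t).pow 2)) |>.congr_deriv
        (by ring))
    · have hp' : (x, y + (0 : ℝ) • v) ∈ slit U := by simpa using hp
      have h1 := (h.hasDerivAt_fibre (h.smooth_dy hE 0) v 0 hp').const_mul (v 0)
      have h2 := (h.hasDerivAt_fibre (h.smooth_dy hE 1) v 0 hp').const_mul (v 1)
      rw [zero_smul, add_zero] at h1 h2
      exact (h1.add h2).sub (HasDerivAt.const_mul c
        ((((hlin 0 0).const_mul 2).mul_const _).add (((hlin 1 0).const_mul 2).mul_const _)))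
  refine ⟨y, hy0, ?_⟩
  rw [Matrix.det_fin_two]
  have hsymm := h.metricTensor_symm hp
  have h0 := hess (EuclideanSpace.single 0 1)
  -- On this vector the quadratic form of `g` equals `g₀₀ det g`.
  have h1 := hess !₂[-metricTensor L (x, y) 0 1, metricTensor L (x, y) 0 0]
  simp [← hsymm] at h0 h1 ⊢
  set a := metricTensor L (x, y) 0 0
  set b := metricTensor L (x, y) 0 1
  set d := metricTensor L (x, y) 1 1
  have ha : 0 < a := hc.trans_le h0
  have h2 : 0 < a * (a * d - b * b) := by
    have : 0 < c * (b ^ 2 + a ^ 2) := by positivity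
    nlinarith
  linarith [pos_of_mul_pos_right h2 ha.le]

/-- The punctured plane is connected, so a nonvanishing determinant keeps its sign on each fibre. -/
theorem det_pos (h : IsPreFinslerOn U L)
    (hdet : ∀ p ∈ slit U, (metricTensor L p).det ≠ 0) {p : Plane × Plane} (hp : p ∈ slit U) :
    0 < (metricTensor L p).det := by
  obtain ⟨x, y⟩ := p
  obtain ⟨z, hz, hzpos⟩ := h.exists_det_pos hp.1
  by_contra! hneg
  have hconn : IsPreconnected ({0}ᶜ : Set Plane) :=
    (isConnected_compl_singleton_of_one_lt_rank (by
      rw [← Module.finrank_eq_rank]; simp) 0).isPreconnected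
  have hcont : ContinuousOn (fun y : Plane => (metricTensor L (x, y)).det) {0}ᶜ := by
    have hm : ∀ i j, ContinuousOn (fun y : Plane => metricTensor L (x, y) i j) {0}ᶜ := fun i j =>
      (h.smooth_metricTensor i j).continuousOn.comp (f := fun y : Plane => (x, y)) (by fun_prop)
        (fun y hy => ⟨hp.1, hy⟩)
    simp only [Matrix.det_fin_two]
    exact ((hm 0 0).mul (hm 1 1)).sub ((hm 0 1).mul (hm 1 0))
  obtain ⟨w, hw, hw0⟩ := hconn.intermediate_value hp.2 hz hcont ⟨hneg, hzpos.le⟩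
  exact hdet (x, w) ⟨hp.1, hw⟩ hw0

end IsPreFinslerOn

/-! ### The calculus of a Finsler function in a chart -/

/-- `L` is a Finsler function over `U`. -/
structure IsFinslerOn (U : Set Plane) (L : Plane × Plane → ℝ) : Prop extends
    IsPreFinslerOn U L where
  det_ne_zero : ∀ p ∈ slit U, (metricTensor L p).det ≠ 0

/-- The points where the Finsler function is equal to `1`. -/
def unitSlit (U : Set Plane) (L : Plane × Plane → ℝ) : Set (Plane × Plane) :=
  {p | p ∈ slit U ∧ L p = 1}

namespace IsFinslerOn

variable {U : Set Plane} {L : Plane × Plane → ℝ} (h : IsFinslerOn U L)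
include h

theorem pos' {p : Plane × Plane} (hp : p ∈ slit U) : 0 < L p := h.pos p.1 hp.1 p.2 hp.2

theorem det_pos {p : Plane × Plane} (hp : p ∈ slit U) : 0 < (metricTensor L p).det :=
  h.toIsPreFinslerOn.det_pos h.det_ne_zero hp

theorem smooth_det : ContDiffOn ℝ ∞ (fun p => (metricTensor L p).det) (slit U) := by
  simp only [Matrix.det_fin_two]
  have hm := h.smooth_metricTensor
  exact ((hm 0 0).mul (hm 1 1)).sub ((hm 0 1).mul (hm 1 0))

theorem smooth_sqrt_det : ContDiffOn ℝ ∞ (fun p => √(metricTensor L p).det) (slit U) :=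
  h.smooth_det.sqrt fun _ hp => (h.det_pos hp).ne'

theorem euler_L {p : Plane × Plane} (hp : p ∈ slit U) :
    p.2 0 * dy 0 L p + p.2 1 * dy 1 L p = L p := by
  obtain ⟨x, y⟩ := p
  have h1 := h.hasDerivAt_fibre h.smooth y 0 (by simpa using hp)
  rw [zero_smul, add_zero] at h1
  have h2 : HasDerivAt (fun t : ℝ => (1 + t) * L (x, y)) (L (x, y)) 0 := by
    simpa using ((hasDerivAt_id (0 : ℝ)).const_add 1).mul_const (L (x, y))
  refine h1.unique (h2.congr_of_eventuallyEq ?_)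
  filter_upwards [lt_mem_nhds (show (-1 : ℝ) < 0 by norm_num)] with t ht
  rw [← h.homog x hp.1 y hp.2 (1 + t) (by linarith), add_smul, one_smul]

omit h in
theorem smooth_fst (Ω : Set (Plane × Plane)) (i : Fin 2) :
    ContDiffOn ℝ ∞ (fun p : Plane × Plane => p.1 i) Ω :=
  ((EuclideanSpace.proj (𝕜 := ℝ) i).contDiff.comp contDiff_fst).contDiffOn

omit h in
theorem smooth_snd (Ω : Set (Plane × Plane)) (i : Fin 2) :
    ContDiffOn ℝ ∞ (fun p : Plane × Plane => p.2 i) Ω :=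
  ((EuclideanSpace.proj (𝕜 := ℝ) i).contDiff.comp contDiff_snd).contDiffOn

omit h in
theorem fderiv_fst (i : Fin 2) (p w : Plane × Plane) :
    fderiv ℝ (fun p : Plane × Plane => p.1 i) p w = w.1 i := by
  have := ((EuclideanSpace.proj i : Plane →L[ℝ] ℝ).comp
    (ContinuousLinearMap.fst ℝ Plane Plane)).hasFDerivAt (x := p)
  exact congrArg (fun T : Plane × Plane →L[ℝ] ℝ => T w) this.fderiv

omit h in
theorem fderiv_snd (i : Fin 2) (p w : Plane × Plane) :
    fderiv ℝ (fun p : Plane × Plane => p.2 i) p w = w.2 i := by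
  have := ((EuclideanSpace.proj i : Plane →L[ℝ] ℝ).comp
    (ContinuousLinearMap.snd ℝ Plane Plane)).hasFDerivAt (x := p)
  exact congrArg (fun T : Plane × Plane →L[ℝ] ℝ => T w) this.fderiv

/-- The calculus on the smooth functions on the slit tangent bundle. -/
def calculus : Calculus (smoothFunctions (slit U)) where
  X i := directional h.isOpen_slit (EuclideanSpace.single i (1 : ℝ), 0)
  Y i := directional h.isOpen_slit (0, EuclideanSpace.single i (1 : ℝ))
  x i := restrictSmooth (fun p => p.1 i) (smooth_fst _ i)
  y i := restrictSmooth (fun p => p.2 i) (smooth_snd _ i)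
  XX _ _ _ := directional_comm _ _ _ _
  YX _ _ _ := directional_comm _ _ _ _
  YY _ _ _ := directional_comm _ _ _ _
  Xx i j := by
    refine ((represents_restrictSmooth _ (smooth_fst _ j)).directional h.isOpen_slit _).unique
      (fun p => ?_)
    beta_reduce
    rw [fderiv_fst]
    fin_cases i <;> fin_cases j <;> simp
  Xy i j := by
    refine ((represents_restrictSmooth _ (smooth_snd _ j)).directional h.isOpen_slit _).unique
      (fun p => ?_)
    beta_reduce
    rw [fderiv_snd]
    rfl
  Yx i j := by
    refine ((represents_restrictSmooth _ (smooth_fst _ j)).directional h.isOpen_slit _).unique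
      (fun p => ?_)
    beta_reduce
    rw [fderiv_fst]
    rfl
  Yy i j := by
    refine ((represents_restrictSmooth _ (smooth_snd _ j)).directional h.isOpen_slit _).unique
      (fun p => ?_)
    beta_reduce
    rw [fderiv_snd]
    fin_cases i <;> fin_cases j <;> simp
  L := restrictSmooth L h.smooth
  Linv := restrictSmooth (fun p => (L p)⁻¹) (h.smooth.inv fun _ hp => (h.pos' hp).ne')
  L_mul_Linv := Subtype.ext <| funext fun p => mul_inv_cancel₀ (h.pos' p.2).ne'
  euler := by
    have hy i := represents_restrictSmooth _ (smooth_snd (slit U) i)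
    have hL := h.represents
    have hd i := hL.directional h.isOpen_slit (0, EuclideanSpace.single i (1 : ℝ))
    exact ((((hy 0).mul (hd 0)).add ((hy 1).mul (hd 1))).congr fun p hp => h.euler_L hp).unique hL
  -- Positivity of the determinant makes this root a unit whose square is the determinant.
  s := restrictSmooth _ h.smooth_sqrt_det
  sinv := restrictSmooth (fun p => (√(metricTensor L p).det)⁻¹)
    (h.smooth_sqrt_det.inv fun _ hp => (Real.sqrt_pos.2 (h.det_pos hp)).ne')
  s_mul_sinv := Subtype.ext <| funext fun p =>
    mul_inv_cancel₀ (Real.sqrt_pos.2 (h.det_pos p.2)).ne'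
  s_sq := by
    have hs := represents_restrictSmooth _ h.smooth_sqrt_det
    have hg (i j : Fin 2) := (Represents.const (Ω := slit U) (1 / 2)).mul
      (((h.represents.pow 2).directional h.isOpen_slit
        (0, EuclideanSpace.single j (1 : ℝ))).directional h.isOpen_slit
        (0, EuclideanSpace.single i (1 : ℝ)))
    refine ((hs.mul hs).congr fun p hp => ?_).unique
      (((hg 0 0).mul (hg 1 1)).sub ((hg 0 1).mul (hg 1 0)))
    rw [Real.mul_self_sqrt (h.det_pos hp).le, Matrix.det_fin_two]
    rfl

/-! ### Identification of the elements of the calculus -/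

theorem represents_X {a : smoothFunctions (slit U)} {f : Plane × Plane → ℝ}
    (ha : Represents a f) (i : Fin 2) : Represents (h.calculus.X i a) (dx i f) :=
  ha.directional h.isOpen_slit _

theorem represents_Y {a : smoothFunctions (slit U)} {f : Plane × Plane → ℝ}
    (ha : Represents a f) (i : Fin 2) : Represents (h.calculus.Y i a) (dy i f) :=
  ha.directional h.isOpen_slit _

theorem represents_y (i : Fin 2) : Represents (h.calculus.y i) (fun p => p.2 i) :=
  fun _ => rfl

theorem represents_L : Represents h.calculus.L L :=
  fun _ => rfl

theorem represents_Linv : Represents h.calculus.Linv (fun p => (L p)⁻¹) :=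
  fun _ => rfl

theorem represents_sinv : Represents h.calculus.sinv (fun p => (√(metricTensor L p).det)⁻¹) :=
  fun _ => rfl

theorem represents_g (i j : Fin 2) :
    Represents (h.calculus.g i j) (fun p => metricTensor L p i j) :=
  (Represents.const _).mul (h.represents_Y (h.represents_Y (h.represents_L.pow 2) j) i)

theorem represents_ginv (i j : Fin 2) :
    Represents (h.calculus.ginv i j) (fun p => (metricTensor L p)⁻¹ i j) := by
  have hs := h.represents_sinv.pow 2
  have hdet : ∀ p ∈ slit U, (√(metricTensor L p).det)⁻¹ ^ 2 = (metricTensor L p).det⁻¹ := by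
    intro p hp
    rw [inv_pow, Real.sq_sqrt (h.det_pos hp).le]
  rw [Calculus.ginv]
  split_ifs with hij
  · subst hij
    refine (hs.mul (h.represents_g (1 - i) (1 - i))).congr fun p hp => ?_
    rw [hdet p hp, Matrix.inv_def, Matrix.adjugate_fin_two, Ring.inverse_eq_inv']
    fin_cases i <;> simp
  · refine (hs.mul (h.represents_g i j)).neg.congr fun p hp => ?_
    rw [hdet p hp, Matrix.inv_def, Matrix.adjugate_fin_two, Ring.inverse_eq_inv']
    fin_cases i <;> fin_cases j <;> simp at hij ⊢

theorem represents_G (i : Fin 2) : Represents (h.calculus.G i) (sprayCoeff L i) := by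
  have hE := h.represents_L.pow 2
  have hb (j : Fin 2) := (((h.represents_y 0).mul (h.represents_X (h.represents_Y hE j) 0)).add
    ((h.represents_y 1).mul (h.represents_X (h.represents_Y hE j) 1))).sub (h.represents_X hE j)
  refine ((Represents.const (1 / 4)).mul (((h.represents_ginv i 0).mul (hb 0)).add
    ((h.represents_ginv i 1).mul (hb 1)))).congr fun p _ => ?_
  simp only [sprayCoeff, Fin.sum_univ_two]

theorem represents_N (i j : Fin 2) : Represents (h.calculus.N i j) (connCoeff L i j) :=
  h.represents_Y (h.represents_G i) j

theorem represents_S {a : smoothFunctions (slit U)} {f : Plane × Plane → ℝ}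
    (ha : Represents a f) : Represents (h.calculus.S a) (along (spray L) f) := by
  rw [Calculus.S_apply]
  refine (((((h.represents_y 0).mul (h.represents_X ha 0)).add
    ((h.represents_y 1).mul (h.represents_X ha 1))).sub
    (((Represents.ofNat 2).mul (h.represents_G 0)).mul (h.represents_Y ha 0))).sub
    (((Represents.ofNat 2).mul (h.represents_G 1)).mul (h.represents_Y ha 1))).congr fun p _ => ?_
  rw [along, fderiv_eq_dx_dy]
  simp [spray]
  ring

theorem represents_R (i j : Fin 2) : Represents (h.calculus.R i j) (jacobiEndo L i j) := by
  refine ((((Represents.ofNat 2).mul (h.represents_X (h.represents_G i) j)).sub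
    (h.represents_S (h.represents_N i j))).sub
    (((h.represents_N i 0).mul (h.represents_N 0 j)).add
    ((h.represents_N i 1).mul (h.represents_N 1 j)))).congr fun p _ => ?_
  simp only [jacobiEndo, Fin.sum_univ_two]

theorem represents_ricci : Represents h.calculus.ricci (ricciScalar L) :=
  ((h.represents_R 0 0).add (h.represents_R 1 1)).congr fun p _ => by
    simp only [ricciScalar, Fin.sum_univ_two]

theorem represents_m (i : Fin 2) : Represents (h.calculus.m i) (fun p => berwaldVec L p i) := by
  have hL := h.represents_L
  fin_cases i
  · refine ((hL.mul h.represents_sinv).mul (h.represents_Y hL 1).neg).congr fun p _ => ?_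
    simp [berwaldVec, div_eq_mul_inv]
  · refine ((hL.mul h.represents_sinv).mul (h.represents_Y hL 0)).congr fun p _ => ?_
    simp [berwaldVec, div_eq_mul_inv]

theorem represents_H {a : smoothFunctions (slit U)} {f : Plane × Plane → ℝ}
    (ha : Represents a f) : Represents (h.calculus.H a) (along (berwaldH L) f) := by
  rw [Calculus.H_apply]
  refine (((((h.represents_m 0).mul (h.represents_X ha 0)).add
    ((h.represents_m 1).mul (h.represents_X ha 1))).sub
    ((((h.represents_N 0 0).mul (h.represents_m 0)).add
      ((h.represents_N 0 1).mul (h.represents_m 1))).mul (h.represents_Y ha 0))).sub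
    ((((h.represents_N 1 0).mul (h.represents_m 0)).add
      ((h.represents_N 1 1).mul (h.represents_m 1))).mul (h.represents_Y ha 1))).congr
    fun p _ => ?_
  rw [along, fderiv_eq_dx_dy]
  simp [berwaldH]
  ring

theorem represents_V {a : smoothFunctions (slit U)} {f : Plane × Plane → ℝ}
    (ha : Represents a f) : Represents (h.calculus.V a) (along (berwaldV L) f) := by
  rw [Calculus.V_apply]
  refine (((h.represents_m 0).mul (h.represents_Y ha 0)).add
    ((h.represents_m 1).mul (h.represents_Y ha 1))).congr fun p _ => ?_
  rw [along, fderiv_eq_dx_dy]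
  simp [berwaldV, almostTangent, berwaldH]

theorem represents_C (i j k : Fin 2) : Represents (h.calculus.C i j k) (cartanTensor L i j k) :=
  (Represents.const _).mul (h.represents_Y (h.represents_g i j) k)

theorem represents_main : Represents h.calculus.main (mainScalar L) := by
  have ht (i j k : Fin 2) := (((h.represents_C i j k).mul (h.represents_m i)).mul
    (h.represents_m j)).mul (h.represents_m k)
  rw [Calculus.main]
  simp only [Fin.sum_univ_two]
  refine ((((((ht 0 0 0).add (ht 0 0 1)).add ((ht 0 1 0).add (ht 0 1 1))).add
    (((ht 1 0 0).add (ht 1 0 1)).add ((ht 1 1 0).add (ht 1 1 1))))).mul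
    (h.represents_Linv.pow 2)).congr fun p _ => ?_
  simp only [mainScalar, Fin.sum_univ_two, div_eq_mul_inv, inv_pow]

/-! ### The ideal of the indicatrix bundle -/

omit h in
/-- The ideal of the functions vanishing where `L = 1`. -/
def indicatrixIdeal (U : Set Plane) (L : Plane × Plane → ℝ) :
    Ideal (smoothFunctions (slit U)) where
  carrier := {a | ∀ p : slit U, L p = 1 → a.1 p = 0}
  add_mem' {a b} ha hb p hp := by simp [ha p hp, hb p hp]
  zero_mem' p hp := rfl
  smul_mem' a b hb p hp := by simp [hb p hp]

omit h in
theorem indicatrixIdeal_isRadical : (indicatrixIdeal U L).IsRadical := by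
  rintro a ⟨n, hn⟩ p hp
  have := hn p hp
  simp only [SubmonoidClass.coe_pow, Pi.pow_apply] at this
  exact eq_zero_of_pow_eq_zero this

/-- A field tangent to the indicatrix bundle preserves its ideal. -/
theorem along_mem {D : Derivation ℝ (smoothFunctions (slit U)) (smoothFunctions (slit U))}
    {Z : Plane × Plane → Plane × Plane}
    (hD : ∀ a f, Represents a f → Represents (D a) (along Z f)) (hDL : D h.calculus.L = 0)
    {a : smoothFunctions (slit U)} (ha : a ∈ indicatrixIdeal U L) :
    D a ∈ indicatrixIdeal U L := by
  intro p hp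
  set f := extendZero a.1 with hf
  have haf : Represents a f := represents_extendZero a
  rw [hD a f haf p]
  -- the projection `(x, y) ↦ (x, y / L)`
  have hLd : HasFDerivAt L (fderiv ℝ L p) p :=
    ((h.smooth.contDiffAt (h.isOpen_slit.mem_nhds p.2)).differentiableAt (by simp)).hasFDerivAt
  have hLZ : fderiv ℝ L p (Z p) = 0 := by
    have := hD _ L h.represents_L p
    rw [hDL] at this
    exact this.symm
  have hπ := (hasFDerivAt_fst (𝕜 := ℝ) (p := p.1)).prodMk
    ((hasFDerivAt_inv (by rw [hp]; norm_num : L p ≠ 0)).comp p.1 hLd |>.smul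
      (hasFDerivAt_snd (𝕜 := ℝ) (p := p.1)))
  have hfd : HasFDerivAt f (fderiv ℝ f p) (p.1.1, (L p)⁻¹ • p.1.2) := by
    rw [hp, inv_one, one_smul]
    exact ((haf.contDiffOn.contDiffAt (h.isOpen_slit.mem_nhds p.2)).differentiableAt
      (by simp)).hasFDerivAt
  have hcomp := hfd.comp p.1 hπ
  have hzero : HasFDerivAt (fun _ : Plane × Plane => (0 : ℝ)) (0 : Plane × Plane →L[ℝ] ℝ) p.1 :=
    hasFDerivAt_const _ _
  -- The projection lands in `{L = 1}`, where `f` vanishes, so the composite is locally zero. Its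
  -- differential fixes `Z p`, because `L p = 1` and `Z` annihilates `L`.
  have heq := hcomp.unique (hzero.congr_of_eventuallyEq (by
    filter_upwards [h.isOpen_slit.mem_nhds p.2] with q hq
    have hLq := h.pos' hq
    have hq' : (q.1, (L q)⁻¹ • q.2) ∈ slit U := ⟨hq.1, smul_ne_zero (inv_pos.2 hLq).ne' hq.2⟩
    have h1 : L (q.1, (L q)⁻¹ • q.2) = 1 := by
      rw [h.homog q.1 hq.1 q.2 hq.2 _ (inv_pos.2 hLq)]
      exact inv_mul_cancel₀ hLq.ne'
    have := ha ⟨_, hq'⟩ h1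
    rw [haf ⟨_, hq'⟩] at this
    exact this))
  have hev := congrArg (fun T : Plane × Plane →L[ℝ] ℝ => T (Z p)) heq
  simpa [hLZ, hp, along] using hev

theorem main_eq_zero (hV : ∀ p ∈ unitSlit U L, along (berwaldV L) (ricciScalar L) p = -mainScalar L p)
    (hS : (∀ p ∈ unitSlit U L, along (spray L) (ricciScalar L) p = 0) ∨
      (∀ p ∈ unitSlit U L, along (spray L) (landsbergScalar L) p = 0)) :
    ∀ p ∈ unitSlit U L, mainScalar L p = 0 := by
  have hV' : h.calculus.V h.calculus.ricci + h.calculus.main ∈ indicatrixIdeal U L := by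
    intro p hp
    rw [((h.represents_V h.represents_ricci).add h.represents_main) p]
    beta_reduce
    rw [hV p ⟨p.2, hp⟩, neg_add_cancel]
  have hSI : ∀ f ∈ indicatrixIdeal U L, h.calculus.S f ∈ indicatrixIdeal U L := fun f hf =>
    h.along_mem (fun _ _ ha => h.represents_S ha) h.calculus.S_L hf
  have hHI : ∀ f ∈ indicatrixIdeal U L, h.calculus.H f ∈ indicatrixIdeal U L := fun f hf =>
    h.along_mem (fun _ _ ha => h.represents_H ha) h.calculus.H_L hf
  have hVI : ∀ f ∈ indicatrixIdeal U L, h.calculus.V f ∈ indicatrixIdeal U L := fun f hf =>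
    h.along_mem (fun _ _ ha => h.represents_V ha) h.calculus.V_L hf
  have key : h.calculus.main ∈ indicatrixIdeal U L := by
    rcases hS with hS | hS
    · refine h.calculus.main_mem_of_S_ricci_mem hSI hHI hVI hV' fun p hp => ?_
      rw [h.represents_S h.represents_ricci p, hS p ⟨p.2, hp⟩]
    · refine h.calculus.main_mem_of_S_S_main_mem indicatrixIdeal_isRadical hVI hV' fun p hp => ?_
      rw [h.represents_S (h.represents_S h.represents_main) p]
      exact hS p ⟨p.2, hp⟩
  rintro p ⟨hp, hp1⟩
  rw [← h.represents_main ⟨p, hp⟩]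
  exact key ⟨p, hp⟩ hp1

theorem cartanTensor_eq_zero {p : Plane × Plane} (hp : p ∈ slit U) (h0 : mainScalar L p = 0)
    (i j k : Fin 2) : cartanTensor L i j k p = 0 := by
  obtain ⟨a, ha⟩ := h.calculus.C_eq i j k
  rw [← h.represents_C i j k ⟨p, hp⟩, ha]
  have := h.represents_main ⟨p, hp⟩
  simp [this, h0]

end IsFinslerOn

/-! ### From a vanishing Cartan tensor to a quadratic form -/

/-- The bilinear form with the matrix `g_{ij}(x, y)` at a fixed `y`. -/
def fibreForm (L : Plane × Plane → ℝ) (x : Plane) : Plane →L[ℝ] Plane →L[ℝ] ℝ :=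
  ∑ i, ∑ j, metricTensor L (x, EuclideanSpace.single 0 (1 : ℝ)) i j •
    (EuclideanSpace.proj i : Plane →L[ℝ] ℝ).smulRight (EuclideanSpace.proj j : Plane →L[ℝ] ℝ)

theorem fibreForm_apply (L : Plane × Plane → ℝ) (x v w : Plane) :
    fibreForm L x v w = ∑ i, ∑ j,
      metricTensor L (x, EuclideanSpace.single 0 (1 : ℝ)) i j * (v i * w j) := by
  simp [fibreForm]

/-- A symmetric bilinear form is determined by its quadratic form. -/
theorem bilin_ext {E : Type*} [AddCommGroup E] [Module ℝ E] [TopologicalSpace E]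
    {B B' : E →L[ℝ] E →L[ℝ] ℝ}
    (hB : ∀ v w, B v w = B w v) (hB' : ∀ v w, B' v w = B' w v) (h : ∀ v, B v v = B' v v)
    (v w : E) : B v w = B' v w := by
  have h1 := h (v + w)
  simp only [map_add, add_apply] at h1
  linarith [h v, h w, hB v w, hB' v w]

namespace IsPreFinslerOn

variable {U : Set Plane} {L : Plane × Plane → ℝ}

theorem smul_mem_slit {x y : Plane} (hp : (x, y) ∈ slit U) {t : ℝ} (ht : 0 < t) :
    (x, t • y) ∈ slit U := ⟨hp.1, smul_ne_zero ht.ne' hp.2⟩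

/-- Fibre derivatives lower the degree of homogeneity by one. -/
theorem dy_smul (h : IsPreFinslerOn U L) {f : Plane × Plane → ℝ}
    (hf : ContDiffOn ℝ ∞ f (slit U)) {t c : ℝ} (ht : 0 < t)
    (hft : ∀ x y : Plane, (x, y) ∈ slit U → f (x, t • y) = t * c * f (x, y)) (i : Fin 2)
    (x y : Plane) (hp : (x, y) ∈ slit U) : dy i f (x, t • y) = c * dy i f (x, y) := by
  set e : Plane := EuclideanSpace.single i (1 : ℝ)
  have hcoord (g : Fin 2 → ℝ) : e 0 * g 0 + e 1 * g 1 = g i := by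
    fin_cases i <;> simp [e]
  -- Differentiate `f(x, t(y + r e)) = t c f(x, y + r e)` at `r = 0`; the velocity `t e` on the left
  -- cancels the factor `t`.
  have h1 := h.hasDerivAt_fibre hf (t • e) (0 : ℝ) (x := x) (y := t • y)
    (by simpa using smul_mem_slit hp ht)
  have h2 := (h.hasDerivAt_fibre hf e (0 : ℝ) (x := x) (y := y) (by simpa using hp)).const_mul
    (t * c)
  simp only [zero_smul, add_zero] at h1 h2
  rw [hcoord fun i => dy i f (x, y)] at h2
  have hnear : ∀ᶠ r : ℝ in nhds 0, (x, y + r • e) ∈ slit U := by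
    have : ContinuousAt (fun r : ℝ => (x, y + r • e)) 0 := by fun_prop
    exact this (by simpa using h.isOpen_slit.mem_nhds hp)
  have h3 := h1.unique (h2.congr_of_eventuallyEq (by
    filter_upwards [hnear] with r hr
    rw [← hft _ _ hr]
    congr 2
    module))
  have h4 := hcoord fun i => dy i f (x, t • y)
  simp only [PiLp.smul_apply, smul_eq_mul] at h3
  have h5 : t * dy i f (x, t • y) = t * (c * dy i f (x, y)) := by
    rw [← h4]; linarith
  exact mul_left_cancel₀ ht.ne' h5

/-- Three fibre derivatives of `L²` lower the degree from two to minus one. -/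
theorem cartanTensor_smul (h : IsPreFinslerOn U L) {t : ℝ} (ht : 0 < t) (i j k : Fin 2)
    {x y : Plane} (hp : (x, y) ∈ slit U) :
    cartanTensor L i j k (x, t • y) = t⁻¹ * cartanTensor L i j k (x, y) := by
  have hE : ContDiffOn ℝ ∞ (fun q => L q ^ 2) (slit U) := h.smooth.pow 2
  have h1 := h.dy_smul (c := t) hE ht (fun x y hp => by
    rw [h.homog x hp.1 y hp.2 t ht]; ring) j
  have h2 := h.dy_smul (c := 1) (h.smooth_dy hE j) ht (fun x y hp => by
    rw [h1 x y hp]; ring) i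
  have h3 := h.dy_smul (c := t⁻¹) (h.smooth_metricTensor i j) ht (fun x y hp => by
    rw [mul_inv_cancel₀ ht.ne']
    simp only [metricTensor, Matrix.of_apply]
    rw [h2 x y hp]; ring) k x y hp
  rw [cartanTensor, h3, cartanTensor]
  ring

theorem metricTensor_eq_of_cartanTensor_eq_zero (h : IsPreFinslerOn U L)
    (hC : ∀ p ∈ slit U, ∀ i j k, cartanTensor L i j k p = 0) (i j : Fin 2) {x : Plane}
    (hx : x ∈ U) {y z : Plane} (hy : y ≠ 0) (hz : z ≠ 0) :
    metricTensor L (x, y) i j = metricTensor L (x, z) i j := by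
  have hconn : IsPreconnected ({0}ᶜ : Set Plane) :=
    (isConnected_compl_singleton_of_one_lt_rank (by
      rw [← Module.finrank_eq_rank]; simp) 0).isPreconnected
  have hder : ∀ y : Plane, y ∈ ({0}ᶜ : Set Plane) →
      HasFDerivAt (fun y : Plane => metricTensor L (x, y) i j) (0 : Plane →L[ℝ] ℝ) y := by
    intro y hy
    have hp : (x, y) ∈ slit U := ⟨hx, hy⟩
    have hd := (((h.smooth_metricTensor i j).contDiffAt (h.isOpen_slit.mem_nhds hp)).differentiableAt
      (by simp)).hasFDerivAt.comp y (hasFDerivAt_prodMk_right x y)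
    refine hd.congr_fderiv (ContinuousLinearMap.ext fun w => ?_)
    have hk (k : Fin 2) : dy k (fun q => metricTensor L q i j) (x, y) = 0 := by
      have := hC _ hp i j k
      rw [cartanTensor] at this
      linarith
    simp [fderiv_eq_dx_dy, hk]
  exact isOpen_compl_singleton.is_const_of_fderiv_eq_zero (𝕜 := ℝ) hconn
    (fun y hy => (hder y hy).differentiableAt.differentiableWithinAt)
    (fun y hy => (hder y hy).fderiv) hy hz

end IsPreFinslerOn

namespace IsFinslerOn

variable {U : Set Plane} {L : Plane × Plane → ℝ}

theorem single_ne_zero : (EuclideanSpace.single 0 (1 : ℝ) : Plane) ≠ 0 := by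
  simp

theorem fibreForm_symm (h : IsFinslerOn U L) {x : Plane} (hx : x ∈ U) (v w : Plane) :
    fibreForm L x v w = fibreForm L x w v := by
  have := h.metricTensor_symm (p := (x, EuclideanSpace.single 0 (1 : ℝ))) ⟨hx, single_ne_zero⟩
  simp only [fibreForm_apply, Fin.sum_univ_two, this]
  ring

/-- The fixed fibre vector is nonzero, so the form only involves the metric tensor on the slit
bundle, where it is smooth. -/
theorem contDiffOn_fibreForm (h : IsFinslerOn U L) : ContDiffOn ℝ ∞ (fibreForm L) U := by
  refine ContDiffOn.sum fun i _ => ContDiffOn.sum fun j _ => ?_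
  have hg := (h.smooth_metricTensor i j).comp (f := fun x : Plane =>
    (x, (EuclideanSpace.single 0 (1 : ℝ) : Plane))) (s := U) (by fun_prop)
    fun x hx => ⟨hx, single_ne_zero⟩
  exact (ContinuousLinearMap.toSpanSingleton ℝ _).contDiff.comp_contDiffOn hg

/-- If the Cartan tensor vanishes, then `L²` is a quadratic form on every fibre. -/
theorem fibreForm_self (h : IsFinslerOn U L)
    (h0 : ∀ p ∈ unitSlit U L, mainScalar L p = 0) {x : Plane} (hx : x ∈ U) {y : Plane}
    (hy : y ≠ 0) : fibreForm L x y y = L (x, y) ^ 2 := by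
  -- Rescaling to `L = 1` extends the vanishing to the whole slit bundle.
  have hC : ∀ p ∈ slit U, ∀ i j k, cartanTensor L i j k p = 0 := by
    rintro ⟨x, y⟩ hp i j k
    have ht := inv_pos.2 (h.pos' hp)
    have hp' := IsPreFinslerOn.smul_mem_slit hp ht
    have h1 : L (x, (L (x, y))⁻¹ • y) = 1 := by
      rw [h.homog x hp.1 y hp.2 _ ht, inv_mul_cancel₀ (h.pos' hp).ne']
    have h2 := h.cartanTensor_smul ht i j k hp
    rw [h.cartanTensor_eq_zero hp' (h0 _ ⟨hp', h1⟩), inv_inv] at h2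
    exact (mul_eq_zero.1 h2.symm).resolve_left (h.pos' hp).ne'
  have hconst i j := h.metricTensor_eq_of_cartanTensor_eq_zero hC i j hx single_ne_zero hy
  have hp : (x, y) ∈ slit U := ⟨hx, hy⟩
  have hg i j := h.represents_g i j
  have hv i := h.represents_y i
  -- The form may be evaluated with the metric at `y` itself, where Euler's identity gives `g(y, y)
  -- = L²`.
  have key := ((((((hg 0 0).mul (hv 0)).mul (hv 0)).add
    ((((Represents.ofNat 2).mul (hg 0 1)).mul (hv 0)).mul (hv 1))).add
    (((hg 1 1).mul (hv 1)).mul (hv 1))) ⟨(x, y), hp⟩).symm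
  rw [h.calculus.g_y_y, (h.represents_L.pow 2) ⟨(x, y), hp⟩] at key
  have hs := h.metricTensor_symm hp
  simp only [fibreForm_apply, Fin.sum_univ_two, hconst, ← hs]
  simp only at key
  linarith

end IsFinslerOn

/-! ### Passage from charts to the manifold -/

section Manifold

variable {M : Type*} [TopologicalSpace M] [ChartedSpace Plane M] [IsManifold (𝓡 2) ∞ M]

theorem mem_tangentChart_target (x₀ : M) (p : Plane × Plane) :
    p ∈ (tangentChart x₀).target ↔ p.1 ∈ (chartAt Plane x₀).target := by
  rw [tangentChart, extChartAt_target]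
  simp
  exact TangentBundle.mem_chart_target_iff p _

theorem tangentChart_symm (x₀ : M) {x : M} (hx : x ∈ (chartAt Plane x₀).source) (y : Plane) :
    (tangentChart x₀).symm (chartAt Plane x₀ x, y) =
      ⟨x, (trivializationAt Plane (TangentSpace (𝓡 2)) x₀).symmL ℝ x y⟩ := by
  have h1 : (tangentChart x₀).symm (chartAt Plane x₀ x, y) =
      (trivializationAt Plane (TangentSpace (𝓡 2)) x₀).toOpenPartialHomeomorph.symm
        ((chartAt Plane x₀).symm (chartAt Plane x₀ x), y) := rfl
  rw [h1, (chartAt Plane x₀).left_inv hx]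
  rw [Bundle.Trivialization.symmL_apply _ hx]
  exact ((trivializationAt Plane (TangentSpace (𝓡 2)) x₀).mk_symm hx y).symm

theorem localExpr_apply (F : TangentBundle (𝓡 2) M → ℝ) (x₀ : M) {x : M}
    (hx : x ∈ (chartAt Plane x₀).source) (y : Plane) :
    localExpr F x₀ (chartAt Plane x₀ x, y) =
      F ⟨x, (trivializationAt Plane (TangentSpace (𝓡 2)) x₀).symmL ℝ x y⟩ := by
  rw [localExpr, tangentChart_symm x₀ hx]

theorem symmL_ne_zero (x₀ : M) {x : M} (hx : x ∈ (chartAt Plane x₀).source) {y : Plane}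
    (hy : y ≠ 0) : (trivializationAt Plane (TangentSpace (𝓡 2)) x₀).symmL ℝ x y ≠ 0 := by
  intro h0
  apply hy
  rw [← (trivializationAt Plane (TangentSpace (𝓡 2)) x₀).continuousLinearMapAt_symmL
    (R := ℝ) (b := x) (by simpa using hx) y, h0, map_zero]

variable {F : TangentBundle (𝓡 2) M → ℝ}

theorem IsFinsler.isFinslerOn (hF : IsFinsler F) (x₀ : M) :
    IsFinslerOn (chartAt Plane x₀).target (localExpr F x₀) where
  isOpen := (chartAt Plane x₀).open_target
  smooth := by
    -- The tangent bundle loses one order of smoothness, harmlessly since `∞ + 1 = ∞`.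
    have : IsManifold (𝓡 2) (∞ + 1) M := inferInstanceAs (IsManifold (𝓡 2) ∞ M)
    have h1 := contMDiffOn_extChartAt_symm (I := (𝓡 2).tangent) (n := ∞)
      (⟨x₀, 0⟩ : TangentBundle (𝓡 2) M)
    have hsub : slit (chartAt Plane x₀).target ⊆ (tangentChart x₀).target := fun p hp =>
      (mem_tangentChart_target x₀ p).2 hp.1
    have h2 := hF.smooth.comp (h1.mono hsub) (by
      rintro ⟨x, y⟩ hp
      have hx := (chartAt Plane x₀).map_target hp.1
      have := tangentChart_symm x₀ hx y
      rw [(chartAt Plane x₀).right_inv hp.1] at this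
      change ((tangentChart x₀).symm (x, y)).2 ≠ 0
      rw [this]
      exact symmL_ne_zero x₀ hx hp.2)
    exact contMDiffOn_iff_contDiffOn.1 h2
  pos x hx y hy := by
    have hx' := (chartAt Plane x₀).map_target hx
    rw [← (chartAt Plane x₀).right_inv hx, localExpr_apply F x₀ hx']
    exact hF.pos _ _ (symmL_ne_zero x₀ hx' hy)
  homog x hx y hy t ht := by
    have hx' := (chartAt Plane x₀).map_target hx
    rw [← (chartAt Plane x₀).right_inv hx, localExpr_apply F x₀ hx', localExpr_apply F x₀ hx',
      map_smul]
    exact hF.homog _ _ _ ht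
  det_ne_zero p hp := hF.nondegenerate x₀ p ((mem_tangentChart_target x₀ p).2 hp.1) hp.2

theorem unitSlit_subset_indicatrix (x₀ : M) {p : Plane × Plane}
    (hp : p ∈ unitSlit (chartAt Plane x₀).target (localExpr F x₀)) : p ∈ indicatrix F x₀ :=
  ⟨(mem_tangentChart_target x₀ p).2 hp.1.1, hp.2⟩

/-- A Finsler structure with vanishing main scalar is a quadratic form on every tangent space. -/
theorem IsFinsler.sq_eq_fibreForm (hF : IsFinsler F) (x₀ : M)
    (h0 : ∀ p ∈ unitSlit (chartAt Plane x₀).target (localExpr F x₀),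
      mainScalar (localExpr F x₀) p = 0) {x : M} (hx : x ∈ (chartAt Plane x₀).source) (y : Plane) :
    fibreForm (localExpr F x₀) (chartAt Plane x₀ x) y y =
      F ⟨x, (trivializationAt Plane (TangentSpace (𝓡 2)) x₀).symmL ℝ x y⟩ ^ 2 := by
  by_cases hy : y = 0
  · subst hy
    simp [hF.zero]
  · rw [(hF.isFinslerOn x₀).fibreForm_self h0 ((chartAt Plane x₀).map_source hx) hy,
      localExpr_apply F x₀ hx]

/-- The fibre form at `x` in the chart at `x`, as a bilinear form on the tangent space. -/
def tangentForm (F : TangentBundle (𝓡 2) M → ℝ) (x : M) :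
    TangentSpace (𝓡 2) x →L[ℝ] TangentSpace (𝓡 2) x →L[ℝ] ℝ :=
  let T : Plane →L[ℝ] Plane :=
    (trivializationAt Plane (TangentSpace (𝓡 2)) x).continuousLinearMapAt ℝ x
  (fibreForm (localExpr F x) (chartAt Plane x x)).bilinearComp T T

theorem tangentForm_apply (x : M) (v w : TangentSpace (𝓡 2) x) :
    tangentForm F x v w = fibreForm (localExpr F x) (chartAt Plane x x)
      ((trivializationAt Plane (TangentSpace (𝓡 2)) x).continuousLinearMapAt ℝ x v)
      ((trivializationAt Plane (TangentSpace (𝓡 2)) x).continuousLinearMapAt ℝ x w) := rfl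

theorem IsFinsler.tangentForm_symm (hF : IsFinsler F) (x : M) (v w : TangentSpace (𝓡 2) x) :
    tangentForm F x v w = tangentForm F x w v := by
  rw [tangentForm_apply, tangentForm_apply]
  exact (hF.isFinslerOn x).fibreForm_symm (mem_chart_target Plane x) _ _

theorem IsFinsler.tangentForm_self (hF : IsFinsler F)
    (h0 : ∀ x₀ : M, ∀ p ∈ unitSlit (chartAt Plane x₀).target (localExpr F x₀),
      mainScalar (localExpr F x₀) p = 0) (x : M) (v : TangentSpace (𝓡 2) x) :
    tangentForm F x v v = F ⟨x, v⟩ ^ 2 := by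
  rw [tangentForm_apply, hF.sq_eq_fibreForm x (h0 x) (mem_chart_source Plane x),
    Bundle.Trivialization.symmL_continuousLinearMapAt _ (by simp)]

/-- A bilinear form that is positive definite on the plane has a bounded unit ball. -/
theorem isVonNBounded_of_pos (B : Plane →L[ℝ] Plane →L[ℝ] ℝ) (hB : ∀ v, v ≠ 0 → 0 < B v v) :
    Bornology.IsVonNBounded ℝ {v : Plane | B v v < 1} := by
  rw [NormedSpace.isVonNBounded_iff]
  obtain ⟨y, hy, hmin⟩ := (isCompact_sphere (0 : Plane) 1).exists_isMinOn
    (NormedSpace.sphere_nonempty.2 zero_le_one)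
    (show ContinuousOn (fun v => B v v) _ by fun_prop)
  have hc : 0 < B y y := hB y (fun h => by simp [h] at hy)
  set c := B y y
  -- With `c` the minimum of the form on the unit circle, `c ‖v‖² ≤ B v v < 1`.
  refine (Metric.isBounded_ball (x := (0 : Plane)) (r := √(c⁻¹))).subset fun v hv => ?_
  rw [mem_ball_zero_iff]
  refine Real.lt_sqrt_of_sq_lt ?_
  by_cases h0 : v = 0
  · simpa [h0] using hc
  have hv' : 0 < ‖v‖ := norm_pos_iff.2 h0
  have h1 : c ≤ B (‖v‖⁻¹ • v) (‖v‖⁻¹ • v) := hmin (by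
    simp [norm_smul, hv'.ne'])
  simp only [map_smul, smul_apply, smul_eq_mul] at h1
  have h2 : c * ‖v‖ ^ 2 < 1 := by
    refine lt_of_le_of_lt ?_ (show B v v < 1 from hv)
    calc c * ‖v‖ ^ 2 ≤ (‖v‖⁻¹ * (‖v‖⁻¹ * B v v)) * ‖v‖ ^ 2 := by gcongr
      _ = B v v := by field_simp
  rw [lt_inv_comm₀ (by positivity) hc, lt_inv_comm₀ hc (by positivity)]
  rw [← one_div, lt_div_iff₀ hc]
  linarith

/-- The form at `x` is built in the chart at `x`, which varies with `x`. Near `x₀` it agrees with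
the smooth form of the fixed chart at `x₀`: both are symmetric with quadratic form `F²`, so
polarization identifies them. -/
theorem IsFinsler.contMDiff_tangentForm (hF : IsFinsler F)
    (h0 : ∀ x₀ : M, ∀ p ∈ unitSlit (chartAt Plane x₀).target (localExpr F x₀),
      mainScalar (localExpr F x₀) p = 0) :
    ContMDiff (𝓡 2) ((𝓡 2).prod 𝓘(ℝ, Plane →L[ℝ] Plane →L[ℝ] ℝ)) ∞
      (fun x : M => Bundle.TotalSpace.mk' (Plane →L[ℝ] Plane →L[ℝ] ℝ)
        (E := fun x : M => TangentSpace (𝓡 2) x →L[ℝ] TangentSpace (𝓡 2) x →L[ℝ] ℝ) x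
        (tangentForm F x)) := by
  intro x₀
  rw [Bundle.contMDiffAt_section]
  have hs : ContMDiffAt (𝓡 2) 𝓘(ℝ, Plane →L[ℝ] Plane →L[ℝ] ℝ) ∞
      (fun x : M => fibreForm (localExpr F x₀) (chartAt Plane x₀ x)) x₀ := by
    have h1 : ContMDiffAt (𝓡 2) 𝓘(ℝ, Plane) ∞ (chartAt Plane x₀) x₀ :=
      contMDiffAt_extChartAt (I := 𝓡 2) (n := ∞) (x := x₀)
    exact ((((hF.isFinslerOn x₀).contDiffOn_fibreForm).contDiffAt
      ((chartAt Plane x₀).open_target.mem_nhds (mem_chart_target Plane x₀))).contMDiffAt).comp x₀ h1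
  refine hs.congr_of_eventuallyEq ?_
  filter_upwards [(chartAt Plane x₀).open_source.mem_nhds (mem_chart_source Plane x₀)] with x hx
  refine ContinuousLinearMap.ext fun v => ContinuousLinearMap.ext fun w => ?_
  have key (v w : Plane) : ((trivializationAt (Plane →L[ℝ] Plane →L[ℝ] ℝ)
      (fun x : M => TangentSpace (𝓡 2) x →L[ℝ] TangentSpace (𝓡 2) x →L[ℝ] ℝ) x₀)
        ⟨x, tangentForm F x⟩).2 v w = tangentForm F x
      ((trivializationAt Plane (TangentSpace (𝓡 2)) x₀).symmL ℝ x v)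
      ((trivializationAt Plane (TangentSpace (𝓡 2)) x₀).symmL ℝ x w) := by
    have hmem : x ∈ (trivializationAt (Plane →L[ℝ] ℝ)
        (fun x : M => TangentSpace (𝓡 2) x →L[ℝ] ℝ) x₀).baseSet := by
      simpa [hom_trivializationAt_baseSet] using hx
    simp only [hom_trivializationAt_apply, ContinuousLinearMap.inCoordinates,
      ContinuousLinearMap.comp_apply, Bundle.Trivialization.continuousLinearMapAt_apply]
    rw [Bundle.Trivialization.coe_linearMapAt_of_mem _ hmem]
    simp [hom_trivializationAt_apply, ContinuousLinearMap.inCoordinates]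
  refine bilin_ext (fun v w => ?_) (fun v w => ?_) (fun v => ?_) v w
  · rw [key, key, hF.tangentForm_symm]
  · exact (hF.isFinslerOn x₀).fibreForm_symm ((chartAt Plane x₀).map_source hx) _ _
  · rw [key, hF.tangentForm_self h0, hF.sq_eq_fibreForm x₀ (h0 x₀) hx]

/-- A Finsler structure with vanishing main scalar is Riemannian. -/
theorem IsFinsler.isRiemannian (hF : IsFinsler F)
    (h0 : ∀ x₀ : M, ∀ p ∈ unitSlit (chartAt Plane x₀).target (localExpr F x₀),
      mainScalar (localExpr F x₀) p = 0) : IsRiemannian F := by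
  have hpos (x : M) (v : TangentSpace (𝓡 2) x) (hv : v ≠ 0) : 0 < tangentForm F x v v := by
    rw [hF.tangentForm_self h0]
    exact pow_pos (hF.pos x v hv) 2
  exact ⟨{ inner := tangentForm F
           symm := hF.tangentForm_symm
           pos := hpos
           isVonNBounded := fun x => isVonNBounded_of_pos (tangentForm F x) (hpos x)
           contMDiff := hF.contMDiff_tangentForm h0 },
    fun x v => (hF.tangentForm_self h0 x v).symm⟩

end Manifold

end FinslerSurface

end

theorem mainTheorem2 {M : Type*} [TopologicalSpace M] [ChartedSpace FinslerSurface.Plane M]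
    [IsManifold (𝓡 2) ∞ M] (F : TangentBundle (𝓡 2) M → ℝ) (hF : FinslerSurface.IsFinsler F)
    (hV : ∀ x₀ : M, ∀ p ∈ FinslerSurface.indicatrix F x₀,
      FinslerSurface.along (FinslerSurface.berwaldV (FinslerSurface.localExpr F x₀))
          (FinslerSurface.ricciScalar (FinslerSurface.localExpr F x₀)) p
        = -FinslerSurface.mainScalar (FinslerSurface.localExpr F x₀) p)
    (hS : (∀ x₀ : M, ∀ p ∈ FinslerSurface.indicatrix F x₀,
        FinslerSurface.along (FinslerSurface.spray (FinslerSurface.localExpr F x₀))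
          (FinslerSurface.ricciScalar (FinslerSurface.localExpr F x₀)) p = 0) ∨
      (∀ x₀ : M, ∀ p ∈ FinslerSurface.indicatrix F x₀,
        FinslerSurface.along (FinslerSurface.spray (FinslerSurface.localExpr F x₀))
          (FinslerSurface.landsbergScalar (FinslerSurface.localExpr F x₀)) p = 0)) :
    FinslerSurface.IsRiemannian F := by
  refine hF.isRiemannian fun x₀ => (hF.isFinslerOn x₀).main_eq_zero
    (fun p hp => hV x₀ p (FinslerSurface.unitSlit_subset_indicatrix x₀ hp)) ?_
  exact hS.imp (fun h p hp => h x₀ p (FinslerSurface.unitSlit_subset_indicatrix x₀ hp))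
    (fun h p hp => h x₀ p (FinslerSurface.unitSlit_subset_indicatrix x₀ hp))
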